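/- Let $(\Omega,(\mathcal F_t)_{t\ge 0},\mathbb P)$ be a filtered probability space and $W$ a one-dimensional Wiener process with respect to $(\mathcal F_t)$ (adapted, with increments after time $s$ independent of $\mathcal F_s$). Let $0<h<T$, let $A\in L^\infty([0,T],\mathbb R^{n\times n})$, $B\in L^\infty([0,T],\mathbb R^{n\times m})$, $\sigma\in L^\infty([0,T],\mathbb R^n)$ be deterministic, and let $\Phi_A(t,s)$, $t,s\in[0,T]$, be the fundamental matrix: $\partial_t\Phi_A(t,s)=A(t)\Phi_A(t,s)$, $\Phi_A(s,s)=I$. Let $Q\in L^\infty([0,T],\mathbb R^{n\times n})$ and $G\in\mathbb R^{n\times n}$ have symmetric positive semidefinite values, and let $R\in L^\infty([0,T],\mathbb R^{m\times m})$ have symmetric positive definite values. Let $U$ be an adapted process in $L^2([0,T]\times\Omega,\mathbb R^m)$, extended by $U(s)=0$ for $s<0$, and let $X$ be an adapted process with almost surely continuous paths that solves on $[0,T]$ $$dX(t)=\big(A(t)X(t)+B(t)U(t-h)\big)\,dt+\sigma(t)\,dW_t,\qquad X(0)=0 .$$ For $t\in[0,T-h]$ let $Y$ be the Artstein transform of $X$,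 $$Y(t)=X(t)+\int_{t-h}^{t}\Phi_A(t,s+h)B(s+h)U(s)\,ds ,$$ and set $$J_R(U,X)=\mathbb E\Big[\int_h^T X(t)^TQ(t)X(t)\,dt+X(T)^TGX(T)\Big]+\mathbb E\Big[\int_0^{T-h}U(t)^TR(t)U(t)\,dt\Big],$$ $$\overline Q(t)=\Phi_A(t+h,t)^TQ(t+h)\Phi_A(t+h,t),\qquad \overline G=\Phi_A(T,T-h)^TG\,\Phi_A(T,T-h),$$ $$V_{min,Q}(t)=\int_{t-h}^t\sigma(s)^T\Phi_A(t,s)^TQ(t)\Phi_A(t,s)\sigma(s)\,ds\quad(h\le t\le T),$$ $V_{min,G}$ being defined in the same way with the constant matrix $G$ in place of $Q(t)$, and $$V_{min}=\int_h^TV_{min,Q}(t)\,dt+V_{min,G}(T).$$ Then all these expectations and integrals are finite, $\overline Q(t)$ (for almost every $t\in[0,T-h]$) and $\overline G$ are symmetric positive semidefinite, and $$J_R(U,X)=\mathbb E\Big[\int_0^{T-h}Y(t)^T\overline Q(t)Y(t)\,dt\Big]+\mathbb E\big[Y(T-h)^T\overline G\,Y(T-h)\big]+\mathbb E\Big[\int_0^{T-h}U(t)^TR(t)U(t)\,dt\Big]+V_{min}.$$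 The constant $V_{min}$ does not depend on $U$, and in particular $J_R(U,X)\ge V_{min}$. -/

import Mathlib

open MeasureTheory ProbabilityTheory Set Filter Topology
open scoped NNReal ENNReal Matrix

noncomputable section

namespace DelaySteering

/-! ### Deterministic data -/

/-- `M ∈ L^∞([0,T], ℝ^{k × l})`. -/
def IsLinfty {k l : ℕ} (T : ℝ) (M : ℝ → Matrix (Fin k) (Fin l) ℝ) : Prop :=
  ∀ i j, MemLp (fun t => M t i j) ⊤ (volume.restrict (Icc 0 T))

/-- `v ∈ L^∞([0,T], ℝ^k)`. -/
def IsLinftyVec {k : ℕ} (T : ℝ) (v : ℝ → Fin k → ℝ) : Prop :=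
  ∀ i, MemLp (fun t => v t i) ⊤ (volume.restrict (Icc 0 T))

/-- `Φ` is, on `[0,T]²`, the Carathéodory solution of `∂ₜ Φ(t,s) = A(t) Φ(t,s)`, `Φ(s,s) = I`
(forward and backward in time), written in integral form. -/
structure IsFundamentalMatrix {n : ℕ} (T : ℝ) (A : ℝ → Matrix (Fin n) (Fin n) ℝ)
    (Φ : ℝ → ℝ → Matrix (Fin n) (Fin n) ℝ) : Prop where
  continuousOn : ∀ s ∈ Icc 0 T, ContinuousOn (fun t => Φ t s) (Icc 0 T)
  integral_eq : ∀ s ∈ Icc 0 T, ∀ t ∈ Icc 0 T, ∀ i j,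
    Φ t s i j = (1 : Matrix (Fin n) (Fin n) ℝ) i j + ∫ τ in s..t, (A τ * Φ τ s) i j

open Classical in
/-- The fundamental matrix `Φ_A(t,s)`, `t, s ∈ [0,T]`, of `A ∈ L^∞([0,T], ℝ^{n × n})`: the solution
of the system in `IsFundamentalMatrix` (it exists, and is unique on `[0,T]²`, for such `A`). -/
def fundamentalMatrix {n : ℕ} (T : ℝ) (A : ℝ → Matrix (Fin n) (Fin n) ℝ) :
    ℝ → ℝ → Matrix (Fin n) (Fin n) ℝ :=
  if H : ∃ Φ, IsFundamentalMatrix T A Φ then H.choose else 0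

/-- The quadratic form `vᵀ M v`. -/
def quadForm {k : ℕ} (M : Matrix (Fin k) (Fin k) ℝ) (v : Fin k → ℝ) : ℝ :=
  v ⬝ᵥ (M *ᵥ v)

/-- `V_{min,Q}(t) = ∫_{t-h}^t σ(s)ᵀ Φ_A(t,s)ᵀ Q(t) Φ_A(t,s) σ(s) ds`. -/
def vMinAt {n : ℕ} (T h : ℝ) (A : ℝ → Matrix (Fin n) (Fin n) ℝ) (σ : ℝ → Fin n → ℝ)
    (Q : ℝ → Matrix (Fin n) (Fin n) ℝ) (t : ℝ) : ℝ :=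
  ∫ s in (t - h)..t, quadForm (Q t) (fundamentalMatrix T A t s *ᵥ σ s)

/-- `V_min = ∫_h^T V_{min,Q}(t) dt + V_{min,G}(T)`. -/
def vMin {n : ℕ} (T h : ℝ) (A : ℝ → Matrix (Fin n) (Fin n) ℝ) (σ : ℝ → Fin n → ℝ)
    (Q : ℝ → Matrix (Fin n) (Fin n) ℝ) (G : Matrix (Fin n) (Fin n) ℝ) : ℝ :=
  (∫ t in h..T, vMinAt T h A σ Q t) + vMinAt T h A σ (fun _ => G) T

/-- `Q̄(t) = Φ_A(t+h,t)ᵀ Q(t+h) Φ_A(t+h,t)`. -/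
def Qbar {n : ℕ} (T h : ℝ) (A Q : ℝ → Matrix (Fin n) (Fin n) ℝ) (t : ℝ) :
    Matrix (Fin n) (Fin n) ℝ :=
  (fundamentalMatrix T A (t + h) t)ᵀ * Q (t + h) * fundamentalMatrix T A (t + h) t

/-- `Ḡ = Φ_A(T,T-h)ᵀ G Φ_A(T,T-h)`. -/
def Gbar {n : ℕ} (T h : ℝ) (A : ℝ → Matrix (Fin n) (Fin n) ℝ)
    (G : Matrix (Fin n) (Fin n) ℝ) : Matrix (Fin n) (Fin n) ℝ :=
  (fundamentalMatrix T A T (T - h))ᵀ * G * fundamentalMatrix T A T (T - h)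

/-! ### Stochastic integral of a deterministic integrand -/

/-- A deterministic step function `∑ᵢ cᵢ 1_{(aᵢ, bᵢ]}` on the half-line. -/
structure StepIntegrand where
  card : ℕ
  left : Fin card → ℝ≥0
  right : Fin card → ℝ≥0
  left_le_right : ∀ i, left i ≤ right i
  coeff : Fin card → ℝ

namespace StepIntegrand

/-- The step function as a function of time. -/
def toFun (φ : StepIntegrand) (t : ℝ) : ℝ :=
  ∑ i, (Ioc (φ.left i : ℝ) (φ.right i)).indicator (fun _ => φ.coeff i) t

/-- The stochastic integral of a step function, `∑ᵢ cᵢ (W_{bᵢ} - W_{aᵢ})`. -/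
def integral {Ω : Type*} (φ : StepIntegrand) (W : ℝ≥0 → Ω → ℝ) (ω : Ω) : ℝ :=
  ∑ i, φ.coeff i * (W (φ.right i) ω - W (φ.left i) ω)

end StepIntegrand

variable {Ω : Type*} {mΩ : MeasurableSpace Ω}

/-- `I` is (a version of) the Itô integral `∫_a^b f(s) dW_s` of the deterministic function `f`:
the `L²(P)`-limit of the integrals of step functions that converge to `f 1_{(a,b]}` in `L²`. -/
def IsWienerIntegral (P : Measure Ω) (W : ℝ≥0 → Ω → ℝ) (f : ℝ → ℝ) (a b : ℝ)
    (I : Ω → ℝ) : Prop :=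
  MemLp I 2 P ∧ ∃ φ : ℕ → StepIntegrand,
    Tendsto (fun k => eLpNorm (fun t => (φ k).toFun t - (Ioc a b).indicator f t) 2 volume)
      atTop (𝓝 0) ∧
    Tendsto (fun k => eLpNorm (fun ω => (φ k).integral W ω - I ω) 2 P) atTop (𝓝 0)

/-! ### Controlled processes -/

/-- `W` is a one-dimensional Wiener process with respect to the filtration `ℱ`: a Brownian motion
adapted to `ℱ` whose increments after time `s` are independent of `ℱ s`. -/
structure IsWienerProcess (P : Measure Ω) (ℱ : Filtration ℝ≥0 mΩ) (W : ℝ≥0 → Ω → ℝ) : Prop where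
  isBrownian : IsBrownianReal W P
  adapted : StronglyAdapted ℱ W
  indep_increment : ∀ s t : ℝ≥0, s ≤ t →
    Indep (MeasurableSpace.comap (fun ω => W t ω - W s ω) inferInstance) (ℱ s) P

/-- `U ∈ L²_ℱ([0,T], ℝ^k)`: square integrable processes on `[0,T] × Ω` adapted to `ℱ`. Only the
values `U t`, `t ∈ [0,T]`, are relevant. -/
structure IsL2Adapted {k : ℕ} (T : ℝ) (P : Measure Ω) (ℱ : Filtration ℝ≥0 mΩ)
    (U : ℝ → Ω → Fin k → ℝ) : Prop where
  memLp : MemLp (fun p : ℝ × Ω => U p.1 p.2) 2 ((volume.restrict (Icc 0 T)).prod P)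
  adapted : ∀ t ∈ Icc 0 T, StronglyMeasurable[ℱ t.toNNReal] (U t)

/-- The control prolonged by `0` to negative times. -/
def zeroHistory {k : ℕ} (U : ℝ → Ω → Fin k → ℝ) (s : ℝ) (ω : Ω) : Fin k → ℝ :=
  if s < 0 then 0 else U s ω

/-- `X` solves on `[0,T]` the delayed equation
`dX(t) = (A(t) X(t) + B(t) U(t-h)) dt + σ(t) dW_t`, `X(0) = 0`, with `U = 0` on `[-h,0)`:
it is adapted, has continuous paths, and satisfies the integrated equation almost surely at
every time. -/
structure IsSolution {n m : ℕ} (P : Measure Ω) (ℱ : Filtration ℝ≥0 mΩ) (W : ℝ≥0 → Ω → ℝ)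
    (T h : ℝ) (A : ℝ → Matrix (Fin n) (Fin n) ℝ) (B : ℝ → Matrix (Fin n) (Fin m) ℝ)
    (σ : ℝ → Fin n → ℝ) (U : ℝ → Ω → Fin m → ℝ) (X : ℝ → Ω → Fin n → ℝ) : Prop where
  adapted : ∀ t ∈ Icc 0 T, StronglyMeasurable[ℱ t.toNNReal] (X t)
  continuousOn : ∀ᵐ ω ∂P, ContinuousOn (fun t => X t ω) (Icc 0 T)
  initial : ∀ᵐ ω ∂P, X 0 ω = 0
  equation : ∀ t ∈ Icc 0 T, ∃ I : Ω → Fin n → ℝ,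
    (∀ i, IsWienerIntegral P W (fun s => σ s i) 0 t (fun ω => I ω i)) ∧
    ∀ᵐ ω ∂P, X t ω =
      (∫ s in (0 : ℝ)..t, (A s *ᵥ X s ω + B s *ᵥ zeroHistory U (s - h) ω)) + I ω

/-- The Artstein transform
`Y(t) = X(t) + ∫_{t-h}^t Φ_A(t,s+h) B(s+h) U(s) ds`, used for `t ∈ [0,T-h]`. -/
def artstein {n m : ℕ} (T h : ℝ) (A : ℝ → Matrix (Fin n) (Fin n) ℝ)
    (B : ℝ → Matrix (Fin n) (Fin m) ℝ) (U : ℝ → Ω → Fin m → ℝ) (X : ℝ → Ω → Fin n → ℝ)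
    (t : ℝ) (ω : Ω) : Fin n → ℝ :=
  X t ω + ∫ s in (t - h)..t,
    (fundamentalMatrix T A t (s + h) * B (s + h)) *ᵥ zeroHistory U s ω

/-- The cost
`J_R(U,X) = E[∫_h^T XᵀQX dt + X(T)ᵀ G X(T)] + E[∫_0^{T-h} UᵀRU dt]`. -/
def cost {n m : ℕ} (P : Measure Ω) (T h : ℝ) (Q : ℝ → Matrix (Fin n) (Fin n) ℝ)
    (G : Matrix (Fin n) (Fin n) ℝ) (R : ℝ → Matrix (Fin m) (Fin m) ℝ)
    (U : ℝ → Ω → Fin m → ℝ) (X : ℝ → Ω → Fin n → ℝ) : ℝ :=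
  (∫ ω, ((∫ t in h..T, quadForm (Q t) (X t ω)) + quadForm G (X T ω)) ∂P) +
    ∫ ω, (∫ t in (0 : ℝ)..(T - h), quadForm (R t) (U t ω)) ∂P

end DelaySteering

end

open DelaySteering

/-!
The transform reduces the delayed problem to one without delay because `X(t)` and the value
`Y(t - h)` of the Artstein transform differ, up to propagation by `Φ = Φ_A`, only by noise that no
control can anticipate:

  `X(t) = Φ(t, t - h) Y(t - h) + ξ`,  `ξ = ∫_{t-h}^t Φ(t,s) σ(s) dW_s`.

The control acting on `[t - h, t]` was chosen before time `t - h`, so `Y(t - h)` is uncorrelated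
with `ξ`, and `E[Xᵀ S X] = E[Yᵀ Φᵀ S Φ Y] + ∫_{t-h}^t (Φσ)ᵀ S (Φσ) ds` for every constant matrix
`S` (`IsSolution.integral_quadForm`). With `S = Q(t)` integrated over `t ∈ [h,T]`, and with
`S = G` at `t = T`, this is the theorem.

The identity for `X(t)` is proved pathwise, without Itô's formula. The noise
`M(t) = X(t) - ∫₀ᵗ (A X + B U(· - h)) ds` has continuous paths and is a version of `∫₀ᵗ σ dW`, and
`X - (M - M(t - h))` is absolutely continuous, so that the deterministic variation of constants
formula (`IsPropagator.variation_of_constants`) applies to it. It produces `ξ` in the form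
`noiseResponse`, `ξ = M(t) - M(t-h) + ∫_{t-h}^t Φ(t,s) A(s) (M(s) - M(t-h)) ds`.

Only second moments of `ξ` are needed. If the correlations of a variable `η` with the increments
of `M` have a density `σ g`, then `E[η ξ] = ∫ Φ(t,s) σ(s) g(s) ds`
(`IsNoise.integral_mul_noiseResponse`), by Fubini and, once more, variation of constants. The
choices `η = Y(t - h)`, then the increments of `M`, then `ξ` itself give that `Y(t - h)` is
uncorrelated with `ξ` and that the covariance of `ξ` is `∫ Φσ(Φσ)ᵀ ds`. The inputs are the Itô
isometry and the orthogonality of the increments of `M` to the past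
(`IsWienerIntegral.integral_mul`, `IsWienerProcess.integral_mul_wienerIntegral_sub`). The control
need not be progressively measurable: the orthogonality of `∫ Φ B U ds` to later increments
follows from that of each `U(s)`, by Fubini.

The fundamental matrix is `Φ(t,s) = Ψ(t) Ψ(s)⁻¹`, where `Ψ` comes from the contraction principle
(`IsLinfty.exists_linear_ode`) and `Ψ⁻¹` from the adjoint equation.
-/

namespace DelaySteering

/-! ### Absolutely continuous functions on `[0,T]` -/

section

theorem integrable_memLp_top_mul {α : Type*} {mα : MeasurableSpace α} {μ : Measure α}
    {g f : α → ℝ} (hg : MemLp g ⊤ μ) (hf : Integrable f μ) :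
    Integrable (fun s => g s * f s) μ := by
  have := (memLp_one_iff_integrable.2 hf).mul' (r := 1) hg
  exact memLp_one_iff_integrable.1 this

theorem memLp_top_of_continuousOn {T : ℝ} {g : ℝ → ℝ} (hg : ContinuousOn g (Icc 0 T)) :
    MemLp g ⊤ (volume.restrict (Icc 0 T)) := by
  obtain ⟨C, hC⟩ := isCompact_Icc.exists_bound_of_continuousOn hg
  refine memLp_top_of_bound (hg.aestronglyMeasurable measurableSet_Icc) C ?_
  exact (ae_restrict_iff' measurableSet_Icc).2 (Eventually.of_forall hC)

theorem intervalIntegrable_of_integrableOn_Icc {T : ℝ} {f : ℝ → ℝ} (hf : IntegrableOn f (Icc 0 T))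
    {s t : ℝ} (hs : s ∈ Icc 0 T) (ht : t ∈ Icc 0 T) : IntervalIntegrable f volume s t := by
  refine (hf.mono_set ?_).intervalIntegrable
  exact uIcc_subset_Icc hs ht

/-- On `[0,T]` the function `f` is a primitive of the integrable function `f'`, that is, `f` is
absolutely continuous there with almost everywhere derivative `f'`. -/
structure IsPrimitiveOn (T : ℝ) (f f' : ℝ → ℝ) : Prop where
  integrableOn : IntegrableOn f' (Icc 0 T)
  eq : ∀ t ∈ Icc 0 T, f t = f 0 + ∫ s in (0 : ℝ)..t, f' s

namespace IsPrimitiveOn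
variable {T : ℝ} {f g f' g' : ℝ → ℝ}

theorem intervalIntegrable (hf : IsPrimitiveOn T f f') {s t : ℝ} (hs : s ∈ Icc 0 T)
    (ht : t ∈ Icc 0 T) : IntervalIntegrable f' volume s t :=
  intervalIntegrable_of_integrableOn_Icc hf.integrableOn hs ht

theorem sub_eq (hf : IsPrimitiveOn T f f') {s t : ℝ} (hs : s ∈ Icc 0 T)
    (ht : t ∈ Icc 0 T) : f t - f s = ∫ u in s..t, f' u := by
  have h0 : (0 : ℝ) ∈ Icc 0 T := ⟨le_rfl, hs.1.trans hs.2⟩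
  rw [hf.eq t ht, hf.eq s hs, ← intervalIntegral.integral_interval_sub_left
    (hf.intervalIntegrable h0 ht) (hf.intervalIntegrable h0 hs)]
  ring

theorem congr (hf : IsPrimitiveOn T f f') (hfg : ∀ t ∈ Icc 0 T, g t = f t)
    (hfg' : ∀ᵐ t ∂(volume.restrict (Icc 0 T)), g' t = f' t) : IsPrimitiveOn T g g' := by
  refine ⟨hf.integrableOn.congr (hfg'.mono fun t ht => ht.symm), fun t ht => ?_⟩
  rw [hfg t ht, hfg 0 ⟨le_rfl, ht.1.trans ht.2⟩, hf.eq t ht]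
  congr 1
  refine intervalIntegral.integral_congr_ae ?_
  filter_upwards [(ae_restrict_iff' measurableSet_Icc).1 hfg'] with s hs hst
  rw [uIoc_of_le ht.1] at hst
  exact (hs ⟨hst.1.le, hst.2.trans ht.2⟩).symm

theorem const (T c : ℝ) : IsPrimitiveOn T (fun _ => c) (fun _ => 0) :=
  ⟨integrableOn_zero, fun t _ => by simp⟩

theorem of_integrableOn (hf : IntegrableOn f' (Icc 0 T)) {r : ℝ} (hr : r ∈ Icc 0 T) :
    IsPrimitiveOn T (fun t => ∫ s in r..t, f' s) f' := by
  refine ⟨hf, fun t ht => ?_⟩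
  have h0 : (0 : ℝ) ∈ Icc 0 T := ⟨le_rfl, hr.1.trans hr.2⟩
  exact (intervalIntegral.integral_add_adjacent_intervals
    (intervalIntegrable_of_integrableOn_Icc hf hr h0)
    (intervalIntegrable_of_integrableOn_Icc hf h0 ht)).symm

theorem add (hf : IsPrimitiveOn T f f') (hg : IsPrimitiveOn T g g') :
    IsPrimitiveOn T (fun t => f t + g t) (fun t => f' t + g' t) := by
  refine ⟨hf.integrableOn.add hg.integrableOn, fun t ht => ?_⟩
  have h0 : (0 : ℝ) ∈ Icc 0 T := ⟨le_rfl, ht.1.trans ht.2⟩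
  rw [intervalIntegral.integral_add (hf.intervalIntegrable h0 ht) (hg.intervalIntegrable h0 ht),
    hf.eq t ht, hg.eq t ht]
  ring

theorem sum {ι : Type*} (s : Finset ι) {f f' : ι → ℝ → ℝ}
    (hf : ∀ i ∈ s, IsPrimitiveOn T (f i) (f' i)) :
    IsPrimitiveOn T (fun t => ∑ i ∈ s, f i t) (fun t => ∑ i ∈ s, f' i t) := by
  classical
  induction s using Finset.induction_on with
  | empty => simpa using const T 0
  | insert a s ha ih =>
    simp only [Finset.sum_insert ha]
    exact (hf a (by simp)).add (ih fun i hi => hf i (by simp [hi]))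

/-- Absolute continuity is stated for the primitive itself, which is defined on the whole line,
while `f` agrees with it on `[0,T]` only. -/
theorem absolutelyContinuous_primitive (hf : IsPrimitiveOn T f f') (hT : 0 ≤ T) :
    AbsolutelyContinuousOnInterval (fun t => f 0 + ∫ s in (0 : ℝ)..t, f' s) 0 T := by
  have h0 : (0 : ℝ) ∈ Icc 0 T := ⟨le_rfl, hT⟩
  have hc : AbsolutelyContinuousOnInterval (fun _ : ℝ => f 0) 0 T :=
    (LipschitzWith.const (f 0)).lipschitzOnWith.absolutelyContinuousOnInterval
  have hi := hf.intervalIntegrable h0 ⟨hT, le_rfl⟩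
  exact hc.add (hi.absolutelyContinuousOnInterval_intervalIntegral (by simp))

theorem continuousOn (hf : IsPrimitiveOn T f f') : ContinuousOn f (Icc 0 T) := by
  rcases lt_or_ge T 0 with hT | hT
  · simp [Icc_eq_empty_of_lt hT]
  have := (hf.absolutelyContinuous_primitive hT).continuousOn
  rw [uIcc_of_le hT] at this
  exact this.congr hf.eq

theorem ae_hasDerivAt (hf : IsPrimitiveOn T f f') (hT : 0 ≤ T) :
    ∀ᵐ t, t ∈ Icc 0 T → HasDerivAt (fun t => f 0 + ∫ s in (0 : ℝ)..t, f' s) (f' t) t := by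
  have h0 : (0 : ℝ) ∈ Icc 0 T := ⟨le_rfl, hT⟩
  have := (hf.intervalIntegrable h0 ⟨hT, le_rfl⟩).ae_hasDerivAt_integral
  rw [uIcc_of_le hT] at this
  filter_upwards [this] with t ht htm
  exact (ht htm 0 h0).const_add _

/-- The product rule for absolutely continuous functions. -/
theorem mul (hf : IsPrimitiveOn T f f') (hg : IsPrimitiveOn T g g') :
    IsPrimitiveOn T (fun t => f t * g t) (fun t => f' t * g t + f t * g' t) := by
  refine ⟨?_, fun t ht => ?_⟩
  · refine Integrable.add ?_ ?_
    · simpa only [mul_comm] using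
        integrable_memLp_top_mul (memLp_top_of_continuousOn hg.continuousOn) hf.integrableOn
    · exact integrable_memLp_top_mul (memLp_top_of_continuousOn hf.continuousOn) hg.integrableOn
  have hT : 0 ≤ T := ht.1.trans ht.2
  have hsub : uIcc 0 t ⊆ uIcc 0 T := by
    rw [uIcc_of_le ht.1, uIcc_of_le hT]; exact Icc_subset_Icc le_rfl ht.2
  have key := AbsolutelyContinuousOnInterval.integral_deriv_mul_eq_sub
    ((hf.absolutelyContinuous_primitive hT).mono hsub)
    ((hg.absolutelyContinuous_primitive hT).mono hsub)
  simp only [intervalIntegral.integral_same, add_zero, ← hf.eq t ht, ← hg.eq t ht] at key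
  rw [← sub_eq_iff_eq_add', ← key]
  refine intervalIntegral.integral_congr_ae ?_
  filter_upwards [hf.ae_hasDerivAt hT, hg.ae_hasDerivAt hT] with s h1 h2 hs
  rw [uIoc_of_le ht.1] at hs
  have hs' : s ∈ Icc 0 T := ⟨hs.1.le, hs.2.trans ht.2⟩
  rw [(h1 hs').deriv, (h2 hs').deriv, ← hf.eq s hs', ← hg.eq s hs']

/-- The product rule for the pairing of two vector functions. -/
theorem dotProduct {ι : Type*} [Fintype ι] {u v u' v' : ℝ → ι → ℝ}
    (hu : ∀ i, IsPrimitiveOn T (fun t => u t i) (fun t => u' t i))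
    (hv : ∀ i, IsPrimitiveOn T (fun t => v t i) (fun t => v' t i)) :
    IsPrimitiveOn T (fun t => u t ⬝ᵥ v t) (fun t => u' t ⬝ᵥ v t + u t ⬝ᵥ v' t) := by
  simp only [_root_.dotProduct, ← Finset.sum_add_distrib]
  exact sum _ fun i _ => (hu i).mul (hv i)

end IsPrimitiveOn

end

/-! ### The fundamental matrix and variation of constants -/

section

variable {n : ℕ} {T : ℝ} {A : ℝ → Matrix (Fin n) (Fin n) ℝ}

theorem IsLinfty.exists_bound {k l : ℕ} {M : ℝ → Matrix (Fin k) (Fin l) ℝ} (hM : IsLinfty T M) :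
    ∃ K : ℝ, 0 ≤ K ∧ ∀ᵐ t ∂(volume.restrict (Icc 0 T)), ∀ v : Fin l → ℝ,
      ‖M t *ᵥ v‖ ≤ K * ‖v‖ := by
  have h1 : ∀ i j, ∃ C : ℝ, ∀ᵐ t ∂(volume.restrict (Icc 0 T)), ‖M t i j‖ ≤ C := fun i j => by
    refine ⟨(eLpNorm (fun t => M t i j) ⊤ (volume.restrict (Icc 0 T))).toReal, ?_⟩
    filter_upwards [ae_le_eLpNormEssSup (f := fun t => M t i j)
      (μ := volume.restrict (Icc 0 T))] with t ht
    rw [← toReal_enorm, eLpNorm_exponent_top]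
    exact ENNReal.toReal_mono (by simpa [eLpNorm_exponent_top] using (hM i j).2.ne) ht
  choose C hC using h1
  refine ⟨∑ i, ∑ j, |C i j|, by positivity, ?_⟩
  have hC' : ∀ᵐ t ∂(volume.restrict (Icc 0 T)), ∀ i j, ‖M t i j‖ ≤ C i j :=
    ae_all_iff.2 fun i => ae_all_iff.2 fun j => hC i j
  filter_upwards [hC'] with t ht v
  refine (pi_norm_le_iff_of_nonneg (by positivity)).2 fun i => ?_
  calc ‖(M t *ᵥ v) i‖ ≤ ∑ j, ‖M t i j * v j‖ :=
        norm_sum_le Finset.univ fun j => M t i j * v j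
    _ ≤ ∑ j, |C i j| * ‖v‖ := by
        refine Finset.sum_le_sum fun j _ => ?_
        rw [norm_mul]
        exact mul_le_mul ((ht i j).trans (le_abs_self _)) (norm_le_pi_norm v j) (norm_nonneg _)
          (abs_nonneg _)
    _ = (∑ j, |C i j|) * ‖v‖ := by rw [Finset.sum_mul]
    _ ≤ _ := by
        refine mul_le_mul_of_nonneg_right ?_ (norm_nonneg _)
        exact Finset.single_le_sum (f := fun i => ∑ j, |C i j|)
          (fun i _ => by positivity) (Finset.mem_univ i)

theorem IsLinfty.mulVec_integrableOn {k l : ℕ} {M : ℝ → Matrix (Fin k) (Fin l) ℝ}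
    (hM : IsLinfty T M) {v : ℝ → Fin l → ℝ} (hv : ∀ j, IntegrableOn (fun t => v t j) (Icc 0 T))
    (i : Fin k) : IntegrableOn (fun t => (M t *ᵥ v t) i) (Icc 0 T) := by
  simp only [Matrix.mulVec, dotProduct]
  exact integrable_finsetSum _ fun j _ => integrable_memLp_top_mul (hM i j) (hv j)

theorem integrableOn_of_continuousOn {f : ℝ → ℝ} (hf : ContinuousOn f (Icc 0 T)) :
    IntegrableOn f (Icc 0 T) :=
  hf.integrableOn_compact isCompact_Icc

/-- A linear system with bounded measurable coefficients has a solution with any initial value.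
The rescaled Picard operator `y ↦ e^{-λt} (x₀ + ∫₀ᵗ e^{λs} A(s) y(s) ds)` is a contraction of
`C([0,T])` as soon as `λ` exceeds the bound of `A`. -/
theorem IsLinfty.exists_linear_ode (hA : IsLinfty T A) (hT : 0 ≤ T) (x₀ : Fin n → ℝ) :
    ∃ x : ℝ → Fin n → ℝ, x 0 = x₀ ∧
      ∀ i, IsPrimitiveOn T (fun t => x t i) (fun t => (A t *ᵥ x t) i) := by
  obtain ⟨K, hK0, hK⟩ := hA.exists_bound
  set l : ℝ := K + 1 with hl
  have hl0 : 0 < l := by positivity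
  have h0 : (0 : ℝ) ∈ Icc 0 T := ⟨le_rfl, hT⟩
  let pr : C(ℝ, Icc (0 : ℝ) T) := ⟨projIcc 0 T hT, continuous_projIcc⟩
  let F : C(Icc (0 : ℝ) T, Fin n → ℝ) → ℝ → Fin n → ℝ :=
    fun y s => Real.exp (l * s) • (A s *ᵥ y (pr s))
  have hFc : ∀ y i, IntegrableOn (fun s => F y s i) (Icc 0 T) := fun y i => by
    have : ∀ s, F y s i = (A s *ᵥ (Real.exp (l * s) • y (pr s))) i := fun s => by
      simp only [F, Matrix.mulVec_smul]
    simp only [this]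
    refine hA.mulVec_integrableOn (v := fun s => Real.exp (l * s) • y (pr s)) (fun j => ?_) i
    refine integrableOn_of_continuousOn (Continuous.continuousOn ?_)
    simp only [Pi.smul_apply, smul_eq_mul]
    fun_prop
  have hFi : ∀ y, IntegrableOn (F y) (Icc 0 T) := fun y => Integrable.of_eval (hFc y)
  have hFii : ∀ y, ∀ t ∈ Icc 0 T, IntervalIntegrable (F y) volume 0 t := fun y t ht =>
    ((hFi y).mono_set (uIcc_subset_Icc h0 ht)).intervalIntegrable
  let S : C(Icc (0 : ℝ) T, Fin n → ℝ) → C(Icc (0 : ℝ) T, Fin n → ℝ) := fun y =>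
    ⟨fun t => Real.exp (-(l * t)) • (x₀ + ∫ s in (0 : ℝ)..t, F y s), by
      have hc := intervalIntegral.continuousOn_primitive_interval (μ := volume) (f := F y)
        (a := 0) (b := T) (by rw [uIcc_of_le hT]; exact hFi y)
      rw [uIcc_of_le hT, continuousOn_iff_continuous_domRestrict] at hc
      have hc' : Continuous fun t : Icc (0 : ℝ) T => ∫ s in (0 : ℝ)..t, F y s := hc
      fun_prop⟩
  have hlip : LipschitzWith (K / l).toNNReal S := by
    refine LipschitzWith.of_dist_le_mul fun y z => ?_
    rw [dist_eq_norm, dist_eq_norm]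
    rw [Real.coe_toNNReal _ (by positivity)]
    refine (ContinuousMap.norm_le _ (by positivity)).2 fun t => ?_
    have e1 : (S y - S z) t = Real.exp (-(l * t)) • ∫ s in (0 : ℝ)..t, (F y s - F z s) := by
      rw [intervalIntegral.integral_sub (hFii y t t.2) (hFii z t t.2)]
      simp only [S, ContinuousMap.sub_apply, ContinuousMap.coe_mk, ← smul_sub,
        add_sub_add_left_eq_sub]
    have e2 : ‖∫ s in (0 : ℝ)..t, (F y s - F z s)‖ ≤
        ∫ s in (0 : ℝ)..t, Real.exp (l * s) * (K * ‖y - z‖) := by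
      refine intervalIntegral.norm_integral_le_of_norm_le t.2.1 ?_
        (Continuous.intervalIntegrable (by fun_prop) _ _)
      filter_upwards [(ae_restrict_iff' measurableSet_Icc).1 hK] with s hs hst
      have hs' := hs ⟨hst.1.le, hst.2.trans t.2.2⟩ ((y - z) (pr s))
      simp only [F, ← smul_sub, ← Matrix.mulVec_sub, norm_smul, Real.norm_eq_abs, Real.abs_exp]
      refine mul_le_mul_of_nonneg_left (hs'.trans ?_) (Real.exp_pos _).le
      exact mul_le_mul_of_nonneg_left ((y - z).norm_coe_le_norm _) hK0
    have e3 : ∫ s in (0 : ℝ)..t, Real.exp (l * s) * (K * ‖y - z‖) =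
        (Real.exp (l * t) - 1) / l * (K * ‖y - z‖) := by
      rw [intervalIntegral.integral_mul_const]
      congr 1
      have hd : ∀ x ∈ uIcc (0 : ℝ) t,
          HasDerivAt (fun s => Real.exp (l * s) / l) (Real.exp (l * x)) x := fun x _ => by
        have := ((hasDerivAt_id x).const_mul l).exp.div_const l
        simpa [hl0.ne'] using this
      rw [intervalIntegral.integral_eq_sub_of_hasDerivAt hd
        (Continuous.intervalIntegrable (by fun_prop) _ _)]
      simp [sub_div]
    rw [e1, norm_smul, Real.norm_eq_abs, Real.abs_exp]
    rw [e3] at e2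
    calc _ ≤ Real.exp (-(l * t)) * ((Real.exp (l * t) - 1) / l * (K * ‖y - z‖)) :=
          mul_le_mul_of_nonneg_left e2 (Real.exp_pos _).le
      _ = (1 - Real.exp (-(l * t))) * (K / l * ‖y - z‖) := by
          have : Real.exp (-(l * t)) * Real.exp (l * t) = 1 := by rw [← Real.exp_add]; simp
          field_simp
          linear_combination (K * ‖y - z‖) * this
      _ ≤ 1 * (K / l * ‖y - z‖) := by
          refine mul_le_mul_of_nonneg_right ?_ (by positivity)
          linarith [Real.exp_pos (-(l * t))]
      _ = _ := one_mul _
  have hcon : ContractingWith (K / l).toNNReal S := by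
    refine ⟨?_, hlip⟩
    rw [Real.toNNReal_lt_one, div_lt_one hl0]
    linarith
  set y := hcon.fixedPoint S with hy
  have hfix : S y = y := hcon.fixedPoint_isFixedPt
  let x : ℝ → Fin n → ℝ := fun t => Real.exp (l * t) • y (pr t)
  have hx : ∀ t ∈ Icc 0 T, x t = x₀ + ∫ s in (0 : ℝ)..t, F y s := fun t ht => by
    have h1 : pr t = ⟨t, ht⟩ := projIcc_of_mem hT ht
    have h2 : y ⟨t, ht⟩ = Real.exp (-(l * t)) • (x₀ + ∫ s in (0 : ℝ)..t, F y s) := by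
      conv_lhs => rw [← hfix]
      rfl
    simp only [x]
    rw [h1, h2, smul_smul, ← Real.exp_add]
    simp
  have hx0 : x 0 = x₀ := by rw [hx 0 h0]; simp
  refine ⟨x, hx0, fun i => ?_⟩
  have hFx : ∀ t, F y t = A t *ᵥ x t := fun t => by simp only [F, x, Matrix.mulVec_smul]
  refine ⟨by simpa only [hFx] using hFc y i, fun t ht => ?_⟩
  rw [hx t ht, hx0]
  simp only [Pi.add_apply, ← hFx]
  congr 1
  rw [intervalIntegral.integral_of_le ht.1, intervalIntegral.integral_of_le ht.1]
  exact eval_integral (fun j => (hFc y j).mono_set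
    (Ioc_subset_Icc_self.trans (Icc_subset_Icc le_rfl ht.2))) i

/-- `Ψ` is the solution of `Ψ' = A Ψ`, `Ψ(0) = I`, and `Z` is the solution of the adjoint system
`Z' = -Z A`, `Z(0) = I`; then `Z = Ψ⁻¹`. -/
structure IsPropagator (T : ℝ) (A Ψ Z : ℝ → Matrix (Fin n) (Fin n) ℝ) : Prop where
  primitive : ∀ i j, IsPrimitiveOn T (fun t => Ψ t i j) (fun t => (A t * Ψ t) i j)
  primitive_inv : ∀ i j, IsPrimitiveOn T (fun t => Z t i j) (fun t => -(Z t * A t) i j)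
  inv_mul : ∀ t ∈ Icc 0 T, Z t * Ψ t = 1
  mul_inv : ∀ t ∈ Icc 0 T, Ψ t * Z t = 1

/-- Along a solution of `y' = A y + g`, the product `Z y` has derivative `Z g`. -/
theorem primitive_inv_mulVec {Z : ℝ → Matrix (Fin n) (Fin n) ℝ}
    (hZ : ∀ i j, IsPrimitiveOn T (fun t => Z t i j) (fun t => -(Z t * A t) i j))
    {y g : ℝ → Fin n → ℝ}
    (hy : ∀ i, IsPrimitiveOn T (fun t => y t i) (fun t => (A t *ᵥ y t) i + g t i)) (i : Fin n) :
    IsPrimitiveOn T (fun t => (Z t *ᵥ y t) i) (fun t => (Z t *ᵥ g t) i) := by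
  have := IsPrimitiveOn.dotProduct (u := fun t => Z t i) (u' := fun t => -(Z t * A t) i)
    (v := y) (v' := fun t => A t *ᵥ y t + g t) (fun j => hZ i j) hy
  refine this.congr (fun t _ => rfl) (Eventually.of_forall fun t => ?_)
  have e : (Z t * A t) i ⬝ᵥ y t = Z t i ⬝ᵥ (A t *ᵥ y t) := by
    change ((Z t * A t) *ᵥ y t) i = (Z t *ᵥ (A t *ᵥ y t)) i
    rw [Matrix.mulVec_mulVec]
  rw [neg_dotProduct, dotProduct_add, e]
  simp [Matrix.mulVec]

theorem IsLinfty.exists_isPropagator (hA : IsLinfty T A) (hT : 0 ≤ T) :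
    ∃ Ψ Z : ℝ → Matrix (Fin n) (Fin n) ℝ, IsPropagator T A Ψ Z := by
  have hA' : IsLinfty T (fun t => -(A t)ᵀ) := fun i j => (hA j i).neg
  choose x hx0 hx using fun j : Fin n => hA.exists_linear_ode hT (Pi.single j 1)
  choose z hz0 hz using fun j : Fin n => hA'.exists_linear_ode hT (Pi.single j 1)
  have h0 : (0 : ℝ) ∈ Icc 0 T := ⟨le_rfl, hT⟩
  let Ψ : ℝ → Matrix (Fin n) (Fin n) ℝ := fun t => Matrix.of fun i j => x j t i
  let Z : ℝ → Matrix (Fin n) (Fin n) ℝ := fun t => Matrix.of fun i j => z i t j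
  have hΨ : ∀ i j, IsPrimitiveOn T (fun t => Ψ t i j) (fun t => (A t * Ψ t) i j) :=
    fun i j => hx j i
  have hZ : ∀ i j, IsPrimitiveOn T (fun t => Z t i j) (fun t => -(Z t * A t) i j) :=
    fun i j => (hz i j).congr (fun t _ => rfl) (Eventually.of_forall fun t => by
      simp [Z, Matrix.mul_apply, Matrix.mulVec, dotProduct, mul_comm])
  have key : ∀ t ∈ Icc 0 T, Z t * Ψ t = 1 := fun t ht => by
    ext i j
    have := (primitive_inv_mulVec hZ (y := x j) (g := 0)
      (fun k => by simpa using hx j k) i).eq t ht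
    have e : ∀ t, (Z t *ᵥ x j t) i = (Z t * Ψ t) i j := fun t => rfl
    rw [e, e] at this
    simp only [Pi.zero_apply, Matrix.mulVec_zero, intervalIntegral.integral_zero, add_zero] at this
    rw [this, ← e, hx0]
    simp [Z, hz0, Matrix.one_apply, Pi.single_apply, eq_comm]
  exact ⟨Ψ, Z, hΨ, hZ, key, fun t ht => mul_eq_one_comm.1 (key t ht)⟩

theorem IsPropagator.isFundamentalMatrix {Ψ Z : ℝ → Matrix (Fin n) (Fin n) ℝ}
    (h : IsPropagator T A Ψ Z) : IsFundamentalMatrix T A (fun t s => Ψ t * Z s) where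
  continuousOn s _ := by
    have : ContinuousOn Ψ (Icc 0 T) :=
      continuousOn_pi.2 fun i => continuousOn_pi.2 fun j => (h.primitive i j).continuousOn
    rw [continuousOn_iff_continuous_domRestrict] at this ⊢
    exact this.matrix_mul continuous_const
  integral_eq s hs t ht i j := by
    have h1 : ∀ τ, (A τ * (Ψ τ * Z s)) i j = ∑ k, (A τ * Ψ τ) i k * Z s k j := fun τ => by
      rw [← Matrix.mul_assoc, Matrix.mul_apply]
    simp only [h1]
    rw [intervalIntegral.integral_finsetSum fun k _ =>
      ((h.primitive i k).intervalIntegrable hs ht).mul_const _]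
    simp only [intervalIntegral.integral_mul_const, ← (h.primitive i _).sub_eq hs ht, sub_mul,
      Finset.sum_sub_distrib]
    rw [← Matrix.mul_apply, ← Matrix.mul_apply, h.mul_inv s hs]
    ring

/-- Uniqueness of the fundamental matrix: `Z Φ(·,s)` has derivative zero. -/
theorem IsFundamentalMatrix.eq_propagator (hA : IsLinfty T A)
    {Φ : ℝ → ℝ → Matrix (Fin n) (Fin n) ℝ}
    {Ψ Z : ℝ → Matrix (Fin n) (Fin n) ℝ} (hΦ : IsFundamentalMatrix T A Φ)
    (h : IsPropagator T A Ψ Z) {t s : ℝ} (ht : t ∈ Icc 0 T) (hs : s ∈ Icc 0 T) :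
    Φ t s = Ψ t * Z s := by
  have h0 : (0 : ℝ) ∈ Icc 0 T := ⟨le_rfl, hs.1.trans hs.2⟩
  have hc : ∀ i j, ContinuousOn (fun τ => Φ τ s i j) (Icc 0 T) := fun i j =>
    continuousOn_pi.1 (continuousOn_pi.1 (hΦ.continuousOn s hs) i) j
  have hi : ∀ i j, IntegrableOn (fun τ => (A τ * Φ τ s) i j) (Icc 0 T) := fun i j =>
    hA.mulVec_integrableOn (v := fun τ k => Φ τ s k j)
      (fun k => integrableOn_of_continuousOn (hc k j)) i
  have hp : ∀ i j, IsPrimitiveOn T (fun τ => Φ τ s i j) (fun τ => (A τ * Φ τ s) i j) :=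
    fun i j => by
      refine ⟨hi i j, fun τ hτ => ?_⟩
      rw [hΦ.integral_eq s hs τ hτ, hΦ.integral_eq s hs 0 h0, add_assoc,
        intervalIntegral.integral_add_adjacent_intervals
          (intervalIntegrable_of_integrableOn_Icc (hi i j) hs h0)
          (intervalIntegrable_of_integrableOn_Icc (hi i j) h0 hτ)]
  have key : Z t * Φ t s = Z s := by
    ext i j
    have := (primitive_inv_mulVec h.primitive_inv (y := fun τ k => Φ τ s k j) (g := 0)
      (fun k => (hp k j).congr (fun _ _ => rfl) (Eventually.of_forall fun _ => add_zero _))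
      i).sub_eq hs ht
    simp only [Pi.zero_apply, Matrix.mulVec_zero, intervalIntegral.integral_zero] at this
    have e : ∀ t, (Z t *ᵥ fun k => Φ t s k j) i = (Z t * Φ t s) i j := fun t => rfl
    rw [e, e, sub_eq_zero] at this
    have h1 : Φ s s = 1 := by
      ext i j
      simp [hΦ.integral_eq s hs s hs]
    rw [this, h1, Matrix.mul_one]
  rw [← key, ← Matrix.mul_assoc, h.mul_inv t ht, Matrix.one_mul]

/-- On `[0,T]²` the fundamental matrix factors as `Φ_A(t,s) = Ψ(t) Ψ(s)⁻¹`. -/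
theorem IsLinfty.exists_fundamentalMatrix_eq (hA : IsLinfty T A) (hT : 0 ≤ T) :
    ∃ Ψ Z : ℝ → Matrix (Fin n) (Fin n) ℝ, IsPropagator T A Ψ Z ∧
      ∀ t ∈ Icc 0 T, ∀ s ∈ Icc 0 T, fundamentalMatrix T A t s = Ψ t * Z s := by
  obtain ⟨Ψ, Z, h⟩ := hA.exists_isPropagator hT
  refine ⟨Ψ, Z, h, fun t ht s hs => ?_⟩
  have H : ∃ Φ, IsFundamentalMatrix T A Φ := ⟨_, h.isFundamentalMatrix⟩
  rw [fundamentalMatrix, dif_pos H]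
  exact H.choose_spec.eq_propagator hA h ht hs

/-- The variation of constants formula on `[r,t]`. -/
theorem IsPropagator.variation_of_constants {Ψ Z : ℝ → Matrix (Fin n) (Fin n) ℝ}
    (h : IsPropagator T A Ψ Z) {y g : ℝ → Fin n → ℝ}
    (hy : ∀ i, IsPrimitiveOn T (fun t => y t i) (fun t => (A t *ᵥ y t) i + g t i))
    {r t : ℝ} (hr : r ∈ Icc 0 T) (ht : t ∈ Icc 0 T) (i : Fin n) :
    y t i = ((Ψ t * Z r) *ᵥ y r) i + ∫ s in r..t, ((Ψ t * Z s) *ᵥ g s) i := by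
  have hp := primitive_inv_mulVec h.primitive_inv hy
  have e1 : y t = Ψ t *ᵥ (Z t *ᵥ y t) := by
    rw [Matrix.mulVec_mulVec, h.mul_inv t ht, Matrix.one_mulVec]
  have e2 : ∫ s in r..t, ((Ψ t * Z s) *ᵥ g s) i =
      ∑ j, Ψ t i j * ((Z t *ᵥ y t) j - (Z r *ᵥ y r) j) := by
    simp only [← Matrix.mulVec_mulVec]
    simp only [(hp _).sub_eq hr ht, ← intervalIntegral.integral_const_mul]
    rw [← intervalIntegral.integral_finsetSum fun j _ =>
      ((hp j).intervalIntegrable hr ht).const_mul _]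
    rfl
  conv_lhs => rw [e1]
  rw [e2, ← Matrix.mulVec_mulVec]
  simp only [Matrix.mulVec, dotProduct, mul_sub, Finset.sum_sub_distrib]
  ring

end

/-! ### The Wiener integral of deterministic functions -/

section

section SquareIntegrable
variable {α : Type*} {mα : MeasurableSpace α} {μ : Measure α}

theorem eLpNorm_two_eq_of_integral_sq_eq {β : Type*} {mβ : MeasurableSpace β} {ν : Measure β}
    {f : α → ℝ} {g : β → ℝ} (hf : MemLp f 2 μ) (hg : MemLp g 2 ν)
    (h : ∫ x, f x * f x ∂μ = ∫ x, g x * g x ∂ν) : eLpNorm f 2 μ = eLpNorm g 2 ν := by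
  rw [hf.eLpNorm_eq_integral_rpow_norm (by simp) (by simp),
    hg.eLpNorm_eq_integral_rpow_norm (by simp) (by simp)]
  simp only [ENNReal.toReal_ofNat, Real.rpow_ofNat, Real.norm_eq_abs, sq_abs]
  simp only [pow_two, h]

/-- Continuity of the `L²` inner product. -/
theorem tendsto_integral_mul_of_tendsto_eLpNorm {F G : ℕ → α → ℝ} {f g : α → ℝ}
    (hF : ∀ k, MemLp (F k) 2 μ) (hG : ∀ k, MemLp (G k) 2 μ) (hf : MemLp f 2 μ) (hg : MemLp g 2 μ)
    (hFf : Tendsto (fun k => eLpNorm (fun x => F k x - f x) 2 μ) atTop (𝓝 0))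
    (hGg : Tendsto (fun k => eLpNorm (fun x => G k x - g x) 2 μ) atTop (𝓝 0)) :
    Tendsto (fun k => ∫ x, F k x * G k x ∂μ) atTop (𝓝 (∫ x, f x * g x ∂μ)) := by
  have h1 : Tendsto (fun k => (hF k).toLp) atTop (𝓝 hf.toLp) :=
    (Lp.tendsto_Lp_iff_tendsto_eLpNorm'' F hF f hf).2 hFf
  have h2 : Tendsto (fun k => (hG k).toLp) atTop (𝓝 hg.toLp) :=
    (Lp.tendsto_Lp_iff_tendsto_eLpNorm'' G hG g hg).2 hGg
  have e : ∀ {u v : α → ℝ} (hu : MemLp u 2 μ) (hv : MemLp v 2 μ),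
      inner ℝ hu.toLp hv.toLp = ∫ x, u x * v x ∂μ := fun hu hv => by
    rw [L2.inner_def]
    refine integral_congr_ae ?_
    filter_upwards [hu.coeFn_toLp, hv.coeFn_toLp] with x hx hy
    rw [hx, hy]
    simp [mul_comm]
  simpa only [e] using h1.inner (𝕜 := ℝ) h2

theorem integral_sub_sub_mul_self {u v w : α → ℝ} (hu : MemLp u 2 μ) (hv : MemLp v 2 μ)
    (hw : MemLp w 2 μ) :
    ∫ x, (u x - v x - w x) * (u x - v x - w x) ∂μ =
      ∫ x, u x * u x ∂μ + ∫ x, v x * v x ∂μ + ∫ x, w x * w x ∂μ -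
        2 * ∫ x, u x * v x ∂μ - 2 * ∫ x, u x * w x ∂μ + 2 * ∫ x, v x * w x ∂μ := by
  have i1 : Integrable (fun x => u x * u x) μ := hu.integrable_mul hu
  have i2 : Integrable (fun x => v x * v x) μ := hv.integrable_mul hv
  have i3 : Integrable (fun x => w x * w x) μ := hw.integrable_mul hw
  have i4 : Integrable (fun x => u x * v x) μ := hu.integrable_mul hv
  have i5 : Integrable (fun x => u x * w x) μ := hu.integrable_mul hw
  have i6 : Integrable (fun x => v x * w x) μ := hv.integrable_mul hw
  rw [← integral_const_mul, ← integral_const_mul, ← integral_const_mul, ← integral_add i1 i2,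
    ← integral_add (by fun_prop) i3, ← integral_sub (by fun_prop) (by fun_prop),
    ← integral_sub (by fun_prop) (by fun_prop), ← integral_add (by fun_prop) (by fun_prop)]
  congr 1 with x
  ring

end SquareIntegrable

namespace StepIntegrand

/-- The restriction of a step function to times after `r`. -/
def restrictIoi (φ : StepIntegrand) (r : ℝ≥0) : StepIntegrand where
  card := φ.card
  left i := max (φ.left i) r
  right i := max (φ.right i) r
  left_le_right i := max_le_max_right _ (φ.left_le_right i)
  coeff := φ.coeff

theorem restrictIoi_toFun (φ : StepIntegrand) (r : ℝ≥0) :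
    (φ.restrictIoi r).toFun = (Ioi (r : ℝ)).indicator φ.toFun := by
  ext t
  simp only [toFun, restrictIoi, indicator_apply, mem_Ioc, mem_Ioi, NNReal.coe_max, max_lt_iff,
    le_max_iff]
  split_ifs with h
  · refine Finset.sum_congr rfl fun i _ => ?_
    have : ¬ t ≤ r := not_le.2 h
    simp [h, this]
  · refine Finset.sum_eq_zero fun i _ => ?_
    simp [h]

theorem memLp_toFun (φ : StepIntegrand) : MemLp φ.toFun 2 volume := by
  have : φ.toFun = ∑ i, (Ioc (φ.left i : ℝ) (φ.right i)).indicator (fun _ => φ.coeff i) := by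
    ext t; simp [toFun]
  rw [this]
  exact memLp_finsetSum' _ fun i _ => memLp_indicator_const 2 measurableSet_Ioc _ (by simp)

end StepIntegrand

section Wiener

variable {Ω : Type*} {mΩ : MeasurableSpace Ω} {P : Measure Ω} {W : ℝ≥0 → Ω → ℝ}

theorem brownian_memLp (hW : IsPreBrownianReal W P) (t : ℝ≥0) : MemLp (W t) 2 P :=
  (hW.isGaussianProcess.hasGaussianLaw_eval t).memLp_two

theorem brownian_integral_mul (hW : IsPreBrownianReal W P) (s t : ℝ≥0) :
    ∫ ω, W s ω * W t ω ∂P = min (s : ℝ) t := by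
  have : IsProbabilityMeasure P := hW.isGaussianProcess.isProbabilityMeasure
  have h := hW.covariance_eval s t
  rw [covariance_eq_sub (brownian_memLp hW s) (brownian_memLp hW t), hW.integral_eval s] at h
  simpa using h

theorem integral_indicator_Ioc_mul_indicator_Ioc {a b c d : ℝ} (hab : a ≤ b) (hcd : c ≤ d)
    (x y : ℝ) :
    ∫ t, (Ioc a b).indicator (fun _ => x) t * (Ioc c d).indicator (fun _ => y) t =
      x * y * (min b d - min b c - min a d + min a c) := by
  have : (fun t => (Ioc a b).indicator (fun _ => x) t * (Ioc c d).indicator (fun _ => y) t) =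
      (Ioc (max a c) (min b d)).indicator (fun _ => x * y) := by
    rw [← Ioc_inter_Ioc]
    ext t
    simp only [indicator_apply, mem_inter_iff]
    split_ifs <;> simp_all
  rw [this, integral_indicator_const _ measurableSet_Ioc, smul_eq_mul, Real.volume_real_Ioc]
  rw [mul_comm]
  congr 1
  simp only [max_def, min_def]
  split_ifs <;> linarith

namespace StepIntegrand

theorem memLp_integral (hW : IsPreBrownianReal W P) (φ : StepIntegrand) :
    MemLp (φ.integral W) 2 P := by
  have : φ.integral W =
      ∑ i, fun ω => φ.coeff i * (W (φ.right i) ω - W (φ.left i) ω) := by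
    ext ω; simp [integral]
  rw [this]
  exact memLp_finsetSum' _ fun i _ =>
    ((brownian_memLp hW _).sub (brownian_memLp hW _)).const_mul _

/-- The Itô isometry for step functions. -/
theorem integral_mul_integral (hW : IsPreBrownianReal W P) (φ ψ : StepIntegrand) :
    ∫ ω, φ.integral W ω * ψ.integral W ω ∂P = ∫ t, φ.toFun t * ψ.toFun t := by
  have m := brownian_memLp hW
  have i1 : ∀ s t, Integrable (fun ω => W s ω * W t ω) P := fun s t => (m s).integrable_mul (m t)
  simp only [integral, toFun, Finset.sum_mul_sum]
  rw [integral_finsetSum, integral_finsetSum]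
  · refine Finset.sum_congr rfl fun i _ => ?_
    rw [integral_finsetSum, integral_finsetSum]
    · refine Finset.sum_congr rfl fun j _ => ?_
      rw [integral_indicator_Ioc_mul_indicator_Ioc (by exact_mod_cast φ.left_le_right i)
        (by exact_mod_cast ψ.left_le_right j)]
      simp only [← brownian_integral_mul hW]
      rw [← integral_sub (i1 _ _) (i1 _ _), ← integral_sub (by fun_prop) (i1 _ _),
        ← integral_add (by fun_prop) (i1 _ _), ← integral_const_mul]
      congr 1 with ω
      ring
    · exact fun j _ => ((memLp_indicator_const 2 measurableSet_Ioc _ (by simp)).integrable_mul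
        (memLp_indicator_const 2 measurableSet_Ioc _ (by simp)))
    · exact fun j _ =>
        (((m _).sub (m _)).const_mul _).integrable_mul (((m _).sub (m _)).const_mul _)
  · exact fun i _ => integrable_finsetSum _ fun j _ =>
      ((memLp_indicator_const 2 measurableSet_Ioc _ (by simp)).integrable_mul
        (memLp_indicator_const 2 measurableSet_Ioc _ (by simp)))
  · exact fun i _ => integrable_finsetSum _ fun j _ =>
      (((m _).sub (m _)).const_mul _).integrable_mul (((m _).sub (m _)).const_mul _)

end StepIntegrand

/-- The polarized Itô isometry. -/
theorem IsWienerIntegral.integral_mul (hW : IsPreBrownianReal W P) {f g : ℝ → ℝ} {a b c d : ℝ}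
    {I J : Ω → ℝ} (hI : IsWienerIntegral P W f a b I) (hJ : IsWienerIntegral P W g c d J)
    (hf : MemLp ((Ioc a b).indicator f) 2 volume) (hg : MemLp ((Ioc c d).indicator g) 2 volume) :
    ∫ ω, I ω * J ω ∂P = ∫ t, (Ioc a b).indicator f t * (Ioc c d).indicator g t := by
  obtain ⟨hI2, φ, hφ, hφI⟩ := hI
  obtain ⟨hJ2, ψ, hψ, hψJ⟩ := hJ
  have h1 := tendsto_integral_mul_of_tendsto_eLpNorm (fun k => (φ k).memLp_integral hW)
    (fun k => (ψ k).memLp_integral hW) hI2 hJ2 hφI hψJ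
  have h2 := tendsto_integral_mul_of_tendsto_eLpNorm (fun k => (φ k).memLp_toFun)
    (fun k => (ψ k).memLp_toFun) hf hg hφ hψ
  simp only [StepIntegrand.integral_mul_integral hW] at h1
  exact tendsto_nhds_unique h1 h2

/-- Increments after time `r` are orthogonal to square integrable `ℱ r`-measurable variables. -/
theorem IsWienerProcess.integral_mul_increment {ℱ : Filtration ℝ≥0 mΩ}
    (hW : IsWienerProcess P ℱ W) {r a b : ℝ≥0} (hra : r ≤ a) (hab : a ≤ b) {η : Ω → ℝ}
    (hη : StronglyMeasurable[ℱ r] η) :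
    ∫ ω, η ω * (W b ω - W a ω) ∂P = 0 := by
  have hB := hW.isBrownian.toIsPreBrownianReal
  have hind : IndepFun η (fun ω => W b ω - W a ω) P := by
    refine (indep_of_indep_of_le_right (hW.indep_increment a b hab) ?_).symm
    exact (hη.mono (ℱ.mono hra)).measurable.comap_le
  rw [hind.integral_fun_mul_eq_mul_integral (hη.mono (ℱ.le r)).aestronglyMeasurable
    ((hB.integrable_eval b).sub (hB.integrable_eval a)).aestronglyMeasurable,
    integral_sub (hB.integrable_eval b) (hB.integrable_eval a), hB.integral_eval,
    hB.integral_eval]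
  simp

theorem IsWienerProcess.integral_mul_restrictIoi {ℱ : Filtration ℝ≥0 mΩ}
    (hW : IsWienerProcess P ℱ W) {r : ℝ≥0} {η : Ω → ℝ} (hη : StronglyMeasurable[ℱ r] η)
    (hη2 : MemLp η 2 P) (φ : StepIntegrand) :
    ∫ ω, η ω * (φ.restrictIoi r).integral W ω ∂P = 0 := by
  have m := brownian_memLp hW.isBrownian.toIsPreBrownianReal
  simp only [StepIntegrand.integral, Finset.mul_sum]
  rw [integral_finsetSum]
  · refine Finset.sum_eq_zero fun i _ => ?_
    simp only [mul_left_comm (η _)]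
    have h : ∫ ω, η ω * (W ((φ.restrictIoi r).right i) ω - W ((φ.restrictIoi r).left i) ω) ∂P = 0 :=
      hW.integral_mul_increment (le_max_right _ _) ((φ.restrictIoi r).left_le_right i) hη
    rw [integral_const_mul, h, mul_zero]
  · exact fun i _ => hη2.integrable_mul (((m _).sub (m _)).const_mul _)

/-- The increment over `(r,s]` of a Wiener integral is orthogonal to the square integrable
`ℱ r`-measurable variables. The isometry shows that this increment is the `L²` limit of integrals
of step functions that vanish before `r`. -/
theorem IsWienerProcess.integral_mul_wienerIntegral_sub {ℱ : Filtration ℝ≥0 mΩ}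
    (hW : IsWienerProcess P ℱ W) {r : ℝ≥0} {s : ℝ} (hrs : r ≤ s) {f : ℝ → ℝ} {I J : Ω → ℝ}
    (hI : IsWienerIntegral P W f 0 s I) (hJ : IsWienerIntegral P W f 0 r J)
    {η : Ω → ℝ} (hη : StronglyMeasurable[ℱ r] η) (hη2 : MemLp η 2 P)
    (hf : MemLp ((Ioc 0 s).indicator f) 2 volume)
    (hg : MemLp ((Ioc 0 (r : ℝ)).indicator f) 2 volume) :
    ∫ ω, η ω * (I ω - J ω) ∂P = 0 := by
  have hB := hW.isBrownian.toIsPreBrownianReal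
  obtain ⟨hI2, φ, hφ, hφI⟩ := hI
  obtain ⟨hJ2, ψ, hψ, hψJ⟩ := hJ
  have mT := fun χ : StepIntegrand => χ.memLp_toFun
  have mI := fun χ : StepIntegrand => χ.memLp_integral hB
  -- `D k` is the discrepancy between the increment and an integral over times after `r`, and `E k`
  -- is the corresponding step function
  let D : ℕ → Ω → ℝ := fun k ω =>
    (φ k).integral W ω - (ψ k).integral W ω - ((φ k).restrictIoi r).integral W ω
  let E : ℕ → ℝ → ℝ := fun k t => (φ k).toFun t - (ψ k).toFun t - ((φ k).restrictIoi r).toFun t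
  have hDm : ∀ k, MemLp (D k) 2 P := fun k => ((mI _).sub (mI _)).sub (mI _)
  have hEm : ∀ k, MemLp (E k) 2 volume := fun k => ((mT _).sub (mT _)).sub (mT _)
  have hDE : ∀ k, eLpNorm (D k) 2 P = eLpNorm (E k) 2 volume := fun k => by
    refine eLpNorm_two_eq_of_integral_sq_eq (hDm k) (hEm k) ?_
    simp only [D, E]
    rw [integral_sub_sub_mul_self (mI _) (mI _) (mI _),
      integral_sub_sub_mul_self (mT _) (mT _) (mT _)]
    simp only [StepIntegrand.integral_mul_integral hB]
  have hE0 : Tendsto (fun k => eLpNorm (E k) 2 volume) atTop (𝓝 0) := by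
    let u : ℕ → ℝ → ℝ := fun k t => (φ k).toFun t - (Ioc 0 s).indicator f t
    let v : ℕ → ℝ → ℝ := fun k t => (ψ k).toFun t - (Ioc 0 (r : ℝ)).indicator f t
    have hE : ∀ k, E k = u k - v k - (Ioi (r : ℝ)).indicator (u k) := fun k => by
      ext t
      simp only [E, u, v, StepIntegrand.restrictIoi_toFun, indicator_apply, Pi.sub_apply, mem_Ioi,
        mem_Ioc]
      by_cases h1 : (r : ℝ) < t
      · have h2 : ¬ t ≤ r := not_le.2 h1
        simp [h1, h2]
      · have h2 : t ≤ r := not_lt.1 h1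
        have h3 : t ≤ s := h2.trans hrs
        simp [h1, h2, h3]
    have mu : ∀ k, MemLp (u k) 2 volume := fun k => (mT _).sub hf
    have mv : ∀ k, MemLp (v k) 2 volume := fun k => (mT _).sub hg
    have hb : ∀ k, eLpNorm (E k) 2 volume ≤
        eLpNorm (u k) 2 volume + eLpNorm (v k) 2 volume + eLpNorm (u k) 2 volume := fun k => by
      rw [hE k]
      refine (eLpNorm_sub_le ((mu k).sub (mv k)).1
        ((mu k).1.indicator measurableSet_Ioi) (by norm_num)).trans ?_
      exact add_le_add (eLpNorm_sub_le (mu k).1 (mv k).1 (by norm_num))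
        (eLpNorm_indicator_le _)
    refine tendsto_of_tendsto_of_tendsto_of_le_of_le tendsto_const_nhds ?_ (fun _ => zero_le) hb
    simpa using (hφ.add hψ).add hφ
  have hη0 : Tendsto (fun _ : ℕ => eLpNorm (fun ω => η ω - η ω) 2 P) atTop (𝓝 0) := by simp
  have hD0 : Tendsto (fun k => ∫ ω, η ω * D k ω ∂P) atTop (𝓝 0) := by
    have := tendsto_integral_mul_of_tendsto_eLpNorm (fun _ => hη2) hDm hη2
      (MemLp.zero (ε := ℝ)) hη0 (g := fun _ => 0) (by simpa only [sub_zero, hDE] using hE0)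
    simpa using this
  have hDe : ∀ k, ∫ ω, η ω * D k ω ∂P =
      ∫ ω, η ω * (φ k).integral W ω ∂P - ∫ ω, η ω * (ψ k).integral W ω ∂P := fun k => by
    have h1 : Integrable (fun ω => η ω * (φ k).integral W ω) P := hη2.integrable_mul (mI _)
    have h2 : Integrable (fun ω => η ω * (ψ k).integral W ω) P := hη2.integrable_mul (mI _)
    have h3 : Integrable (fun ω => η ω * ((φ k).restrictIoi r).integral W ω) P :=
      hη2.integrable_mul (mI _)
    simp only [D, mul_sub]
    rw [integral_sub (by fun_prop) h3, integral_sub h1 h2, hW.integral_mul_restrictIoi hη hη2,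
      sub_zero]
  have hlim := (tendsto_integral_mul_of_tendsto_eLpNorm (fun _ => hη2) (fun k => mI (φ k)) hη2
    hI2 hη0 hφI).sub (tendsto_integral_mul_of_tendsto_eLpNorm (fun _ => hη2)
      (fun k => mI (ψ k)) hη2 hJ2 hη0 hψJ)
  simp only [← hDe] at hlim
  have := tendsto_nhds_unique hlim hD0
  have i1 : Integrable (fun ω => η ω * I ω) P := hη2.integrable_mul hI2
  have i2 : Integrable (fun ω => η ω * J ω) P := hη2.integrable_mul hJ2
  simp only [mul_sub]
  rw [integral_sub i1 i2, this]

end Wiener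

end

/-! ### Square integrable processes and their time integrals -/

section

theorem ae_prod_of_ae {α β : Type*} {mα : MeasurableSpace α} {mβ : MeasurableSpace β}
    {μ : Measure α} {ν : Measure β} [SFinite ν] {p : α → Prop} {q : β → Prop}
    (hp : ∀ᵐ x ∂μ, p x) (hq : ∀ᵐ y ∂ν, q y) : ∀ᵐ z ∂(μ.prod ν), p z.1 ∧ q z.2 :=
  (Measure.quasiMeasurePreserving_fst.ae hp).and (Measure.quasiMeasurePreserving_snd.ae hq)

theorem integral_sq_le {α : Type*} {mα : MeasurableSpace α} {μ : Measure α} [IsFiniteMeasure μ]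
    {f : α → ℝ} (hf : MemLp f 2 μ) : (∫ x, f x ∂μ) ^ 2 ≤ μ.real univ * ∫ x, f x ^ 2 ∂μ := by
  rcases eq_or_ne (μ.real univ) 0 with h0 | h0
  · have : μ = 0 := by simpa [Measure.real, ENNReal.toReal_eq_zero_iff] using h0
    simp [this]
  have hpos : 0 < μ.real univ := lt_of_le_of_ne measureReal_nonneg h0.symm
  have i1 : Integrable f μ := hf.integrable one_le_two
  have i2 : Integrable (fun x => f x ^ 2) μ := hf.integrable_sq
  set m := ∫ x, f x ∂μ with hm
  have key : 0 ≤ ∫ x, (μ.real univ * f x - m) ^ 2 ∂μ := integral_nonneg fun x => sq_nonneg _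
  have e : ∫ x, (μ.real univ * f x - m) ^ 2 ∂μ =
      μ.real univ * (μ.real univ * ∫ x, f x ^ 2 ∂μ - m ^ 2) := by
    have : ∀ x, (μ.real univ * f x - m) ^ 2 =
        μ.real univ ^ 2 * f x ^ 2 - 2 * μ.real univ * m * f x + m ^ 2 := fun x => by ring
    simp only [this]
    rw [integral_add (by fun_prop) (by fun_prop), integral_sub (by fun_prop) (by fun_prop),
      integral_const_mul, integral_const_mul, ← hm, integral_const, smul_eq_mul]
    ring
  rw [e] at key
  linarith [nonneg_of_mul_nonneg_right key hpos]

section TimeIntegral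

variable {Ω : Type*} {mΩ : MeasurableSpace Ω} {P : Measure Ω} {T : ℝ}

/-- Lebesgue measure on `[0,T]` times `P`. -/
noncomputable abbrev timeProd (T : ℝ) (P : Measure Ω) : Measure (ℝ × Ω) :=
  (volume.restrict (Icc 0 T)).prod P

/-- A process with almost surely continuous paths is jointly measurable up to a null set. -/
theorem aestronglyMeasurable_of_continuousOn_paths [SFinite P] {f : ℝ → Ω → ℝ}
    (hf : ∀ t ∈ Icc 0 T, AEStronglyMeasurable (f t) P)
    (hc : ∀ᵐ ω ∂P, ContinuousOn (fun t => f t ω) (Icc 0 T)) :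
    AEStronglyMeasurable (fun p : ℝ × Ω => f p.1 p.2) (timeProd T P) := by
  classical
  -- `G k j` is a measurable version of `f (j / k)`; the process is the limit of its values at
  -- `⌊tk⌋/k`
  let G : ℕ → ℕ → Ω → ℝ := fun k j =>
    if h : (j : ℝ) / (k : ℝ) ∈ Icc 0 T then (hf _ h).mk else 0
  have hG : ∀ k j, Measurable (G k j) := fun k j => by
    by_cases h : (j : ℝ) / (k : ℝ) ∈ Icc 0 T
    · simp only [G, dif_pos h]
      exact (hf _ h).stronglyMeasurable_mk.measurable
    · simp only [G, dif_neg h]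
      exact measurable_const
  have hGe : ∀ᵐ ω ∂P, ∀ k j : ℕ, (j : ℝ) / (k : ℝ) ∈ Icc 0 T → G k j ω = f (j / k) ω := by
    refine ae_all_iff.2 fun k => ae_all_iff.2 fun j => ?_
    by_cases h : (j : ℝ) / (k : ℝ) ∈ Icc 0 T
    · filter_upwards [(hf _ h).ae_eq_mk] with ω hω _
      simp only [G, dif_pos h, hω]
    · exact Eventually.of_forall fun ω h' => absurd h' h
  refine aestronglyMeasurable_of_tendsto_ae atTop
    (f := fun (k : ℕ) (p : ℝ × Ω) => G k ⌊p.1 * k⌋₊ p.2) (fun k => ?_) ?_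
  · have h1 : Measurable fun q : ℕ × Ω => G k q.1 q.2 := measurable_from_prod_countable_right (hG k)
    have h2 : Measurable fun p : ℝ × Ω => ((⌊p.1 * k⌋₊, p.2) : ℕ × Ω) :=
      ((Nat.measurable_floor.comp (measurable_fst.mul_const _))).prodMk measurable_snd
    exact (h1.comp h2).aestronglyMeasurable
  · filter_upwards [ae_prod_of_ae (ae_restrict_mem (μ := volume) (s := Icc 0 T) measurableSet_Icc)
      (hGe.and hc)] with p hp
    obtain ⟨ht, hω, hcont⟩ := hp
    have h1 : Tendsto (fun k : ℕ => (⌊p.1 * k⌋₊ : ℝ) / (k : ℝ)) atTop (𝓝 p.1) :=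
      (tendsto_nat_floor_mul_div_atTop ht.1).comp tendsto_natCast_atTop_atTop
    have h2 : ∀ k : ℕ, (⌊p.1 * k⌋₊ : ℝ) / (k : ℝ) ∈ Icc 0 T := fun k => by
      refine ⟨by positivity, le_trans ?_ ht.2⟩
      rcases Nat.eq_zero_or_pos k with rfl | hk
      · simpa using ht.1
      · rw [div_le_iff₀ (by positivity)]
        exact Nat.floor_le (mul_nonneg ht.1 (by positivity))
    have h3 := (hcont p.1 ht).tendsto.comp
      (tendsto_nhdsWithin_iff.2 ⟨h1, Eventually.of_forall h2⟩)
    refine h3.congr fun k => ?_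
    exact (hω k _ (h2 k)).symm

variable [IsProbabilityMeasure P] {f : ℝ → Ω → ℝ}

theorem memLp_two_of_sq_le {α : Type*} {mα : MeasurableSpace α} {μ : Measure α} {f D : α → ℝ}
    (hf : AEStronglyMeasurable f μ) (hD : Integrable D μ) (h : ∀ᵐ x ∂μ, f x ^ 2 ≤ D x) :
    MemLp f 2 μ := by
  refine (memLp_two_iff_integrable_sq hf).2 (hD.mono' (hf.pow 2) ?_)
  filter_upwards [h] with x hx
  rwa [Real.norm_eq_abs, abs_of_nonneg (sq_nonneg _)]

theorem memLp_top_mul {g : ℝ → ℝ} (hg : MemLp g ⊤ (volume.restrict (Icc 0 T)))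
    (hf : MemLp (fun p : ℝ × Ω => f p.1 p.2) 2 (timeProd T P)) :
    MemLp (fun p : ℝ × Ω => g p.1 * f p.1 p.2) 2 (timeProd T P) :=
  hf.mul' (hg.comp_fst P)

theorem ae_memLp_slice (hf : MemLp (fun p : ℝ × Ω => f p.1 p.2) 2 (timeProd T P)) :
    ∀ᵐ ω ∂P, MemLp (fun t => f t ω) 2 (volume.restrict (Icc 0 T)) := by
  filter_upwards [(hf.integrable one_le_two).prod_left_ae, hf.integrable_sq.prod_left_ae]
    with ω h1 h2
  exact (memLp_two_iff_integrable_sq h1.aestronglyMeasurable).2 h2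

theorem ae_memLp_slice_left (hf : MemLp (fun p : ℝ × Ω => f p.1 p.2) 2 (timeProd T P)) :
    ∀ᵐ t ∂(volume.restrict (Icc 0 T)), MemLp (f t) 2 P := by
  filter_upwards [(hf.integrable one_le_two).prod_right_ae, hf.integrable_sq.prod_right_ae]
    with ω h1 h2
  exact (memLp_two_iff_integrable_sq h1.aestronglyMeasurable).2 h2

theorem ae_integrableOn_slice (hf : MemLp (fun p : ℝ × Ω => f p.1 p.2) 2 (timeProd T P)) :
    ∀ᵐ ω ∂P, IntegrableOn (fun t => f t ω) (Icc 0 T) :=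
  (hf.integrable one_le_two).prod_left_ae

theorem memLp_timeProd_mono (hf : MemLp (fun p : ℝ × Ω => f p.1 p.2) 2 (timeProd T P))
    {s : Set ℝ} (hs : s ⊆ Icc 0 T) :
    MemLp (fun p : ℝ × Ω => f p.1 p.2) 2 ((volume.restrict s).prod P) :=
  hf.mono_measure (Measure.prod_mono (Measure.restrict_mono hs le_rfl) le_rfl)

theorem aestronglyMeasurable_primitive
    (hf : MemLp (fun p : ℝ × Ω => f p.1 p.2) 2 (timeProd T P)) {r t : ℝ} (hr : r ∈ Icc 0 T)
    (ht : t ∈ Icc 0 T) :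
    AEStronglyMeasurable (fun ω => ∫ s in r..t, f s ω) P := by
  have h : ∀ {r t : ℝ}, r ∈ Icc 0 T → t ∈ Icc 0 T →
      AEStronglyMeasurable (fun ω => ∫ s in Ioc r t, f s ω) P := fun {r t} hr ht =>
    (memLp_timeProd_mono hf (Ioc_subset_Icc_self.trans
      (Icc_subset_Icc hr.1 ht.2))).1.prod_swap.integral_prod_right'
  exact (h hr ht).sub (h ht hr)

/-- By Cauchy–Schwarz, the square of a time integral is dominated uniformly in time. -/
theorem ae_primitive_sq_le (hf : MemLp (fun p : ℝ × Ω => f p.1 p.2) 2 (timeProd T P)) :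
    ∀ᵐ ω ∂P, ∀ t ∈ Icc 0 T,
      (∫ s in (0 : ℝ)..t, f s ω) ^ 2 ≤ T * ∫ s in Icc 0 T, f s ω ^ 2 := by
  filter_upwards [ae_memLp_slice hf] with ω hω t ht
  have hsub : Ioc 0 t ⊆ Icc 0 T := Ioc_subset_Icc_self.trans (Icc_subset_Icc le_rfl ht.2)
  rw [intervalIntegral.integral_of_le ht.1]
  refine (integral_sq_le (hω.mono_measure (Measure.restrict_mono hsub le_rfl))).trans ?_
  refine mul_le_mul ?_ ?_ (integral_nonneg fun _ => sq_nonneg _) (ht.1.trans ht.2)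
  · simp [ht.1, ht.2]
  · exact setIntegral_mono_set hω.integrable_sq (Eventually.of_forall fun _ => sq_nonneg _)
      hsub.eventuallyLE

theorem integrable_slice_sq (hf : MemLp (fun p : ℝ × Ω => f p.1 p.2) 2 (timeProd T P)) :
    Integrable (fun ω => T * ∫ s in Icc 0 T, f s ω ^ 2) P :=
  hf.integrable_sq.integral_prod_right.const_mul T

theorem memLp_primitive (hf : MemLp (fun p : ℝ × Ω => f p.1 p.2) 2 (timeProd T P)) {t : ℝ}
    (ht : t ∈ Icc 0 T) : MemLp (fun ω => ∫ s in (0 : ℝ)..t, f s ω) 2 P :=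
  memLp_two_of_sq_le (aestronglyMeasurable_primitive hf ⟨le_rfl, ht.1.trans ht.2⟩ ht)
    (integrable_slice_sq hf) ((ae_primitive_sq_le hf).mono fun _ h => h t ht)

theorem ae_continuousOn_primitive
    (hf : MemLp (fun p : ℝ × Ω => f p.1 p.2) 2 (timeProd T P)) (hT : 0 ≤ T) :
    ∀ᵐ ω ∂P, ContinuousOn (fun t => ∫ s in (0 : ℝ)..t, f s ω) (Icc 0 T) := by
  filter_upwards [ae_integrableOn_slice hf] with ω hω
  exact (IsPrimitiveOn.of_integrableOn hω ⟨le_rfl, hT⟩).continuousOn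

theorem memLp_timeProd_primitive
    (hf : MemLp (fun p : ℝ × Ω => f p.1 p.2) 2 (timeProd T P)) (hT : 0 ≤ T) :
    MemLp (fun p : ℝ × Ω => ∫ s in (0 : ℝ)..p.1, f s p.2) 2 (timeProd T P) := by
  refine memLp_two_of_sq_le
    (aestronglyMeasurable_of_continuousOn_paths (f := fun t ω => ∫ s in (0 : ℝ)..t, f s ω)
      (fun t ht => (memLp_primitive hf ht).1) (ae_continuousOn_primitive hf hT))
    ((integrable_slice_sq hf).comp_snd (volume.restrict (Icc 0 T))) ?_
  filter_upwards [ae_prod_of_ae (ae_restrict_mem (μ := volume) (s := Icc 0 T) measurableSet_Icc)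
    (ae_primitive_sq_le hf)] with p hp
  exact hp.2 p.1 hp.1

theorem integrable_mul_timeProd
    (hf : MemLp (fun p : ℝ × Ω => f p.1 p.2) 2 (timeProd T P)) {η : Ω → ℝ} (hη : MemLp η 2 P) :
    Integrable (fun p : ℝ × Ω => η p.2 * f p.1 p.2) (timeProd T P) :=
  (hη.comp_snd _).integrable_mul hf

theorem integral_mul_primitive
    (hf : MemLp (fun p : ℝ × Ω => f p.1 p.2) 2 (timeProd T P)) {η : Ω → ℝ} (hη : MemLp η 2 P)
    {r t : ℝ} (hr : r ∈ Icc 0 T) (ht : t ∈ Icc 0 T) (hrt : r ≤ t) :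
    ∫ ω, η ω * (∫ s in r..t, f s ω) ∂P = ∫ s in r..t, ∫ ω, η ω * f s ω ∂P := by
  have hsub : Ioc r t ⊆ Icc 0 T := Ioc_subset_Icc_self.trans (Icc_subset_Icc hr.1 ht.2)
  simp only [intervalIntegral.integral_of_le hrt, ← integral_const_mul]
  have hi : Integrable (fun p : ℝ × Ω => η p.2 * f p.1 p.2) ((volume.restrict (Ioc r t)).prod P) :=
    (integrable_mul_timeProd hf hη).mono_measure
      (Measure.prod_mono (Measure.restrict_mono hsub le_rfl) le_rfl)
  exact (integral_integral_swap hi).symm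

end TimeIntegral

section Delay
variable {Ω : Type*} {mΩ : MeasurableSpace Ω} {P : Measure Ω} {T h : ℝ}
  {m : ℕ} {ℱ : Filtration ℝ≥0 mΩ} {U : ℝ → Ω → Fin m → ℝ}

/-- The delayed control `s ↦ U(s - h)` is square integrable on `[0,T] × Ω`. -/
theorem IsL2Adapted.memLp_zeroHistory [IsProbabilityMeasure P]
    (hU : IsL2Adapted T P ℱ U) (hh : 0 ≤ h) (l : Fin m) :
    MemLp (fun p : ℝ × Ω => zeroHistory U (p.1 - h) p.2 l) 2 (timeProd T P) := by
  have h1 : MemLp (fun p : ℝ × Ω => U p.1 p.2 l) 2 (timeProd T P) := hU.memLp.eval l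
  have e1 : timeProd T P = (volume.prod P).restrict (Icc 0 T ×ˢ univ) := by
    rw [timeProd, ← Measure.prod_restrict, Measure.restrict_univ]
  rw [e1, ← memLp_indicator_iff_restrict (measurableSet_Icc.prod MeasurableSet.univ)] at h1
  have hmp : MeasurePreserving (fun p : ℝ × Ω => (p.1 - h, p.2)) (volume.prod P)
      (volume.prod P) :=
    (measurePreserving_sub_right volume h).prod (MeasurePreserving.id P)
  have h2 := (h1.comp_measurePreserving hmp).restrict (Icc 0 T ×ˢ univ)
  rw [← e1] at h2
  refine (memLp_congr_ae ?_).1 h2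
  filter_upwards [ae_prod_of_ae (ae_restrict_mem (μ := volume) (s := Icc 0 T) measurableSet_Icc)
    (Eventually.of_forall (p := fun _ : Ω => True) fun _ => trivial)] with p hp
  obtain ⟨⟨h3, h4⟩, -⟩ := hp
  by_cases h5 : p.1 - h < 0
  · simp [indicator, zeroHistory, h5, not_le.2 h5]
  · have h6 : p.1 ≤ T + h := by linarith
    have h7 : h ≤ p.1 := by linarith
    simp [indicator, zeroHistory, h6, h7, not_lt.2 h7]

theorem IsL2Adapted.stronglyMeasurable_zeroHistory (hU : IsL2Adapted T P ℱ U) {r s : ℝ}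
    (hs : s ∈ Icc 0 T) (hh : 0 ≤ h) (hr : s - h ≤ r) (l : Fin m) :
    StronglyMeasurable[ℱ r.toNNReal] (fun ω => zeroHistory U (s - h) ω l) := by
  by_cases h1 : s - h < 0
  · simp only [zeroHistory, h1, if_true, Pi.zero_apply]
    exact stronglyMeasurable_const
  · simp only [zeroHistory, h1, if_false]
    have := (hU.adapted (s - h) ⟨not_lt.1 h1, by linarith [hs.2]⟩).mono
      (ℱ.mono (Real.toNNReal_le_toNNReal hr))
    exact (continuous_apply l).comp_stronglyMeasurable this

end Delay

end

/-! ### The noise of a solution -/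

section

variable {Ω : Type*} {mΩ : MeasurableSpace Ω} {P : Measure Ω}
  {ℱ : Filtration ℝ≥0 mΩ} {W : ℝ≥0 → Ω → ℝ} {n m : ℕ} {T h : ℝ}
  {A : ℝ → Matrix (Fin n) (Fin n) ℝ} {B : ℝ → Matrix (Fin n) (Fin m) ℝ} {σ : ℝ → Fin n → ℝ}
  {U : ℝ → Ω → Fin m → ℝ} {X : ℝ → Ω → Fin n → ℝ}

/-- The properties of `M(t) = ∫₀ᵗ σ dW` on `[0,T]` that determine the second moments of what is
driven by it: square integrability, orthogonality of the increments after `r` to `ℱ r`, and the covariance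
`∫_r^{min(s,s')} σᵢ σⱼ` of two increments starting at `r`. -/
structure IsNoise (P : Measure Ω) (ℱ : Filtration ℝ≥0 mΩ) (T : ℝ) (σ : ℝ → Fin n → ℝ)
    (M : ℝ → Ω → Fin n → ℝ) : Prop where
  memLp : ∀ i, MemLp (fun p : ℝ × Ω => M p.1 p.2 i) 2 (timeProd T P)
  memLp_time : ∀ t ∈ Icc 0 T, ∀ i, MemLp (fun ω => M t ω i) 2 P
  integral_mul_sub : ∀ r ∈ Icc 0 T, ∀ s ∈ Icc 0 T, r ≤ s → ∀ η : Ω → ℝ,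
    StronglyMeasurable[ℱ r.toNNReal] η → MemLp η 2 P → ∀ i,
      ∫ ω, η ω * (M s ω i - M r ω i) ∂P = 0
  integral_sub_mul_sub : ∀ r ∈ Icc 0 T, ∀ s ∈ Icc 0 T, ∀ s' ∈ Icc 0 T, r ≤ s → r ≤ s' → ∀ i j,
    ∫ ω, (M s' ω j - M r ω j) * (M s ω i - M r ω i) ∂P =
      ∫ u in r..s, σ u i * (Ioc r s').indicator (fun u => σ u j) u

theorem IsWienerIntegral.congr {f : ℝ → ℝ} {a b : ℝ} {I J : Ω → ℝ}
    (hI : IsWienerIntegral P W f a b I) (h : J =ᵐ[P] I) : IsWienerIntegral P W f a b J := by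
  obtain ⟨h2, φ, h3, h4⟩ := hI
  refine ⟨(memLp_congr_ae h).2 h2, φ, h3, ?_⟩
  refine h4.congr fun k => eLpNorm_congr_ae ?_
  filter_upwards [h] with ω hω
  rw [hω]

theorem IsLinftyVec.memLp_indicator (hσ : IsLinftyVec T σ) (i : Fin n) {r t : ℝ} (hr : r ∈ Icc 0 T)
    (ht : t ∈ Icc 0 T) : MemLp ((Ioc r t).indicator fun s => σ s i) 2 volume := by
  rw [memLp_indicator_iff_restrict measurableSet_Ioc]
  have : MemLp (fun s => σ s i) 2 (volume.restrict (Icc 0 T)) := (hσ i).mono_exponent le_top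
  exact this.mono_measure (Measure.restrict_mono (Ioc_subset_Icc_self.trans
    (Icc_subset_Icc hr.1 ht.2)) le_rfl)

/-- A family of Wiener integrals `M(t) = ∫₀ᵗ σ dW` with almost surely continuous paths. -/
theorem isNoise_of_isWienerIntegral [IsProbabilityMeasure P] (hW : IsWienerProcess P ℱ W)
    (hT : 0 ≤ T) (hσ : IsLinftyVec T σ) {M : ℝ → Ω → Fin n → ℝ}
    (hM : ∀ t ∈ Icc 0 T, ∀ i, IsWienerIntegral P W (fun s => σ s i) 0 t (fun ω => M t ω i))
    (hc : ∀ i, ∀ᵐ ω ∂P, ContinuousOn (fun t => M t ω i) (Icc 0 T)) : IsNoise P ℱ T σ M := by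
  have hB := hW.isBrownian.toIsPreBrownianReal
  have h0 : (0 : ℝ) ∈ Icc 0 T := ⟨le_rfl, hT⟩
  have iso : ∀ s ∈ Icc 0 T, ∀ t ∈ Icc 0 T, ∀ i j, ∫ ω, M s ω i * M t ω j ∂P =
      ∫ u, (Ioc 0 s).indicator (fun u => σ u i) u * (Ioc 0 t).indicator (fun u => σ u j) u :=
    fun s hs t ht i j => (hM s hs i).integral_mul hB (hM t ht j) (hσ.memLp_indicator i h0 hs)
      (hσ.memLp_indicator j h0 ht)
  have m2 : ∀ t ∈ Icc 0 T, ∀ i, MemLp (fun ω => M t ω i) 2 P := fun t ht i => (hM t ht i).1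
  refine ⟨fun i => ?_, m2, fun r hr s hs hrs η hη hη2 i => ?_,
    fun r hr s hs s' hs' hrs hrs' i j => ?_⟩
  · have hmeas := aestronglyMeasurable_of_continuousOn_paths (P := P) (T := T)
      (f := fun t ω => M t ω i) (fun t ht => (m2 t ht i).1) (hc i)
    refine (memLp_two_iff_integrable_sq hmeas).2 ((integrable_prod_iff (hmeas.pow 2)).2 ⟨?_, ?_⟩)
    · filter_upwards [ae_restrict_mem measurableSet_Icc] with t ht
      exact (m2 t ht i).integrable_sq
    · have hσ2 : IntegrableOn (fun u => σ u i * σ u i) (Icc 0 T) :=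
        integrable_memLp_top_mul (hσ i) ((hσ i).integrable le_top)
      refine (integrableOn_of_continuousOn
        (IsPrimitiveOn.of_integrableOn hσ2 h0).continuousOn).congr ?_
      filter_upwards [ae_restrict_mem measurableSet_Icc] with t ht
      simp only [Pi.pow_apply, norm_pow, Real.norm_eq_abs, sq_abs]
      simp only [pow_two]
      rw [iso t ht t ht, intervalIntegral.integral_of_le ht.1,
        ← integral_indicator measurableSet_Ioc]
      congr 1 with u
      simp only [indicator_apply]
      split_ifs <;> simp
  · refine hW.integral_mul_wienerIntegral_sub (r := r.toNNReal) (s := s) ?_ (hM s hs i) ?_ hη hη2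
      (hσ.memLp_indicator i h0 hs) ?_ <;> rw [Real.coe_toNNReal r hr.1]
    · exact hrs
    · exact hM r hr i
    · exact hσ.memLp_indicator i h0 hr
  · have i1 : ∀ s ∈ Icc 0 T, ∀ t ∈ Icc 0 T, Integrable (fun ω => M s ω j * M t ω i) P :=
      fun s hs t ht => (m2 s hs j).integrable_mul (m2 t ht i)
    have i2 : ∀ s ∈ Icc 0 T, ∀ t ∈ Icc 0 T, Integrable (fun u =>
        (Ioc 0 s).indicator (fun u => σ u j) u * (Ioc 0 t).indicator (fun u => σ u i) u) :=
      fun s hs t ht => (hσ.memLp_indicator j h0 hs).integrable_mul (hσ.memLp_indicator i h0 ht)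
    have j1 := i1 s' hs' s hs
    have j2 := i1 s' hs' r hr
    have j3 := i1 r hr s hs
    have j4 := i1 r hr r hr
    have k1 := i2 s' hs' s hs
    have k2 := i2 s' hs' r hr
    have k3 := i2 r hr s hs
    have k4 := i2 r hr r hr
    have e : ∀ ω, (M s' ω j - M r ω j) * (M s ω i - M r ω i) =
        M s' ω j * M s ω i - M s' ω j * M r ω i - M r ω j * M s ω i + M r ω j * M r ω i :=
      fun ω => by ring
    simp only [e]
    rw [integral_add (by fun_prop) j4, integral_sub (by fun_prop) j3, integral_sub j1 j2,
      iso s' hs' s hs, iso s' hs' r hr, iso r hr s hs, iso r hr r hr, ← integral_sub k1 k2,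
      ← integral_sub (by fun_prop) k3, ← integral_add (by fun_prop) k4,
      intervalIntegral.integral_of_le hrs, ← integral_indicator measurableSet_Ioc]
    congr 1 with u
    simp only [indicator_apply, mem_Ioc]
    by_cases h1 : 0 < u
    · by_cases h2 : r < u
      · simp [h1, h2, not_le.2 h2]
        split_ifs <;> ring
      · have h3 : u ≤ r := not_lt.1 h2
        simp [h1, h2, h3, h3.trans hrs, h3.trans hrs']
    · have h2 : ¬ r < u := not_lt.2 ((not_lt.1 h1).trans hr.1)
      simp [h1, h2]

/-- The drift `A X + B U(· - h)`. -/
noncomputable def drift (h : ℝ) (A : ℝ → Matrix (Fin n) (Fin n) ℝ)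
    (B : ℝ → Matrix (Fin n) (Fin m) ℝ) (U : ℝ → Ω → Fin m → ℝ) (X : ℝ → Ω → Fin n → ℝ)
    (s : ℝ) (ω : Ω) : Fin n → ℝ :=
  A s *ᵥ X s ω + B s *ᵥ zeroHistory U (s - h) ω

/-- The pathwise version `X(t) - ∫₀ᵗ (A X + B U(· - h)) ds` of the Wiener integral `∫₀ᵗ σ dW`,
which has almost surely continuous paths. -/
noncomputable def noise (h : ℝ) (A : ℝ → Matrix (Fin n) (Fin n) ℝ)
    (B : ℝ → Matrix (Fin n) (Fin m) ℝ) (U : ℝ → Ω → Fin m → ℝ) (X : ℝ → Ω → Fin n → ℝ)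
    (t : ℝ) (ω : Ω) : Fin n → ℝ :=
  fun i => X t ω i - ∫ s in (0 : ℝ)..t, drift h A B U X s ω i

theorem IsSolution.ae_continuousOn (hX : IsSolution P ℱ W T h A B σ U X) :
    ∀ᵐ ω ∂P, ∀ i, ContinuousOn (fun t => X t ω i) (Icc 0 T) := by
  filter_upwards [hX.continuousOn] with ω hω i
  exact continuousOn_pi.1 hω i

theorem ae_zeroHistory_integrableOn [IsProbabilityMeasure P] (hU : IsL2Adapted T P ℱ U)
    (hh : 0 ≤ h) :
    ∀ᵐ ω ∂P, ∀ l, IntegrableOn (fun s => zeroHistory U (s - h) ω l) (Icc 0 T) :=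
  ae_all_iff.2 fun l => ae_integrableOn_slice (f := fun s ω => zeroHistory U (s - h) ω l)
    (hU.memLp_zeroHistory hh l)

theorem IsSolution.ae_drift_integrableOn [IsProbabilityMeasure P]
    (hX : IsSolution P ℱ W T h A B σ U X) (hA : IsLinfty T A) (hB : IsLinfty T B)
    (hU : IsL2Adapted T P ℱ U) (hh : 0 ≤ h) :
    ∀ᵐ ω ∂P, ∀ i, IntegrableOn (fun s => drift h A B U X s ω i) (Icc 0 T) := by
  filter_upwards [hX.ae_continuousOn, ae_zeroHistory_integrableOn hU hh] with ω h1 h2 i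
  exact (hA.mulVec_integrableOn (fun j => integrableOn_of_continuousOn (h1 j)) i).add
    (hB.mulVec_integrableOn h2 i)

theorem IsSolution.isNoise [IsProbabilityMeasure P] (hW : IsWienerProcess P ℱ W)
    (hX : IsSolution P ℱ W T h A B σ U X) (hA : IsLinfty T A) (hB : IsLinfty T B)
    (hσ : IsLinftyVec T σ) (hU : IsL2Adapted T P ℱ U) (hh : 0 ≤ h) (hT : 0 ≤ T) :
    IsNoise P ℱ T σ (noise h A B U X) := by
  have h0 : (0 : ℝ) ∈ Icc 0 T := ⟨le_rfl, hT⟩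
  have hd := hX.ae_drift_integrableOn hA hB hU hh
  refine isNoise_of_isWienerIntegral hW hT hσ (fun t ht i => ?_) fun i => ?_
  · obtain ⟨I, hI, hXI⟩ := hX.equation t ht
    refine (hI i).congr ?_
    filter_upwards [hXI, hd] with ω h1 h2
    have h3 : (∫ s in (0 : ℝ)..t, drift h A B U X s ω) i =
        ∫ s in (0 : ℝ)..t, drift h A B U X s ω i := by
      rw [intervalIntegral.integral_of_le ht.1, intervalIntegral.integral_of_le ht.1]
      exact eval_integral (fun j => (h2 j).mono_set
        (Ioc_subset_Icc_self.trans (Icc_subset_Icc le_rfl ht.2))) i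
    rw [noise, ← h3, h1]
    simp [drift]
  · filter_upwards [hX.ae_continuousOn, hd] with ω h1 h2
    exact (h1 i).sub (IsPrimitiveOn.of_integrableOn (h2 i) h0).continuousOn

end

section

variable {Ω : Type*} {mΩ : MeasurableSpace Ω} {P : Measure Ω}
  {ℱ : Filtration ℝ≥0 mΩ} {W : ℝ≥0 → Ω → ℝ} {n m : ℕ} {T h : ℝ}
  {A : ℝ → Matrix (Fin n) (Fin n) ℝ} {B : ℝ → Matrix (Fin n) (Fin m) ℝ} {σ : ℝ → Fin n → ℝ}
  {U : ℝ → Ω → Fin m → ℝ} {X : ℝ → Ω → Fin n → ℝ} {M : ℝ → Ω → Fin n → ℝ}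
  {Ψ Z : ℝ → Matrix (Fin n) (Fin n) ℝ}

/-! ### Linear images of square integrable processes -/

theorem IsLinfty.mul {k l q : ℕ} {M : ℝ → Matrix (Fin k) (Fin l) ℝ}
    {N : ℝ → Matrix (Fin l) (Fin q) ℝ} (hM : IsLinfty T M) (hN : IsLinfty T N) :
    IsLinfty T (fun t => M t * N t) := fun i j => by
  simp only [Matrix.mul_apply]
  exact memLp_finsetSum _ fun k _ => (hN k j).mul' (hM i k)

theorem IsLinfty.const {k l : ℕ} (M : Matrix (Fin k) (Fin l) ℝ) : IsLinfty T (fun _ => M) :=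
  fun _ _ => memLp_const _

theorem IsPropagator.isLinfty (hp : IsPropagator T A Ψ Z) : IsLinfty T Ψ :=
  fun i j => memLp_top_of_continuousOn (hp.primitive i j).continuousOn

theorem IsPropagator.isLinfty_inv (hp : IsPropagator T A Ψ Z) : IsLinfty T Z :=
  fun i j => memLp_top_of_continuousOn (hp.primitive_inv i j).continuousOn

theorem IsLinfty.memLp_mulVec [IsProbabilityMeasure P] {k l : ℕ}
    {M : ℝ → Matrix (Fin k) (Fin l) ℝ} (hM : IsLinfty T M) {v : ℝ → Ω → Fin l → ℝ}
    (hv : ∀ j, MemLp (fun p : ℝ × Ω => v p.1 p.2 j) 2 (timeProd T P)) (i : Fin k) :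
    MemLp (fun p : ℝ × Ω => (M p.1 *ᵥ v p.1 p.2) i) 2 (timeProd T P) := by
  simp only [Matrix.mulVec, dotProduct]
  exact memLp_finsetSum _ fun j _ => memLp_top_mul (f := fun t ω => v t ω j) (hM i j) (hv j)

theorem memLp_mulVec_const {k l : ℕ} (M : Matrix (Fin k) (Fin l) ℝ) {v : Ω → Fin l → ℝ}
    (hv : ∀ j, MemLp (fun ω => v ω j) 2 P) (i : Fin k) : MemLp (fun ω => (M *ᵥ v ω) i) 2 P := by
  simp only [Matrix.mulVec, dotProduct]
  exact memLp_finsetSum _ fun j _ => (hv j).const_mul _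

theorem integral_mul_mulVec {k l : ℕ} (M : Matrix (Fin k) (Fin l) ℝ) {v : Ω → Fin l → ℝ}
    {η : Ω → ℝ} (hη : MemLp η 2 P) (hv : ∀ j, MemLp (fun ω => v ω j) 2 P) (i : Fin k) :
    ∫ ω, η ω * (M *ᵥ v ω) i ∂P = (M *ᵥ fun j => ∫ ω, η ω * v ω j ∂P) i := by
  simp only [Matrix.mulVec, dotProduct, Finset.mul_sum]
  rw [integral_finsetSum]
  · refine Finset.sum_congr rfl fun j _ => ?_
    rw [← integral_const_mul]
    congr 1 with ω
    ring
  · exact fun j _ => hη.integrable_mul ((hv j).const_mul _)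

theorem memLp_interval_primitive [IsProbabilityMeasure P] {f : ℝ → Ω → ℝ}
    (hf : MemLp (fun p : ℝ × Ω => f p.1 p.2) 2 (timeProd T P)) {r t : ℝ} (hr : r ∈ Icc 0 T)
    (ht : t ∈ Icc 0 T) : MemLp (fun ω => ∫ s in r..t, f s ω) 2 P := by
  have h0 : (0 : ℝ) ∈ Icc 0 T := ⟨le_rfl, ht.1.trans ht.2⟩
  refine (memLp_congr_ae ?_).1 ((memLp_primitive hf ht).sub (memLp_primitive hf hr))
  filter_upwards [ae_integrableOn_slice hf] with ω hω
  exact intervalIntegral.integral_interval_sub_left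
    (intervalIntegrable_of_integrableOn_Icc hω h0 ht)
    (intervalIntegrable_of_integrableOn_Icc hω h0 hr)

/-! ### The response to the noise -/

/-- The pathwise form, after an integration by parts, of the Wiener integral
`∫_r^t Φ_A(t,s) σ(s) dW_s`, where `M = ∫ σ dW`. -/
noncomputable def noiseResponse (A Ψ Z : ℝ → Matrix (Fin n) (Fin n) ℝ) (M : ℝ → Ω → Fin n → ℝ)
    (r t : ℝ) (ω : Ω) : Fin n → ℝ := fun i =>
  (M t ω i - M r ω i) + ∫ s in r..t, ((Ψ t * Z s) *ᵥ (A s *ᵥ (M s ω - M r ω))) i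

theorem IsNoise.memLp_sub [IsProbabilityMeasure P] (hM : IsNoise P ℱ T σ M) {r : ℝ}
    (hr : r ∈ Icc 0 T) (j : Fin n) :
    MemLp (fun p : ℝ × Ω => (M p.1 p.2 - M r p.2) j) 2 (timeProd T P) :=
  (hM.memLp j).sub ((hM.memLp_time r hr j).comp_snd _)

theorem IsNoise.memLp_response_integrand [IsProbabilityMeasure P] (hM : IsNoise P ℱ T σ M)
    (hp : IsPropagator T A Ψ Z) (hA : IsLinfty T A) {r t : ℝ} (hr : r ∈ Icc 0 T)
    (i : Fin n) :
    MemLp (fun p : ℝ × Ω => ((Ψ t * Z p.1) *ᵥ (A p.1 *ᵥ (M p.1 p.2 - M r p.2))) i) 2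
      (timeProd T P) :=
  ((IsLinfty.const (Ψ t)).mul hp.isLinfty_inv).memLp_mulVec
    (v := fun s ω => A s *ᵥ (M s ω - M r ω))
    (hA.memLp_mulVec (v := fun s ω => M s ω - M r ω) (hM.memLp_sub hr)) i

theorem IsNoise.memLp_noiseResponse [IsProbabilityMeasure P] (hM : IsNoise P ℱ T σ M)
    (hp : IsPropagator T A Ψ Z) (hA : IsLinfty T A) {r t : ℝ} (hr : r ∈ Icc 0 T)
    (ht : t ∈ Icc 0 T) (i : Fin n) :
    MemLp (fun ω => noiseResponse A Ψ Z M r t ω i) 2 P :=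
  ((hM.memLp_time t ht i).sub (hM.memLp_time r hr i)).add
    (memLp_interval_primitive (f := fun s ω => ((Ψ t * Z s) *ᵥ (A s *ᵥ (M s ω - M r ω))) i)
      (hM.memLp_response_integrand hp hA hr i) hr ht)

/-- If the correlation of `η` with the increments `M(s) - M(r)` has density `σ g`, then its
correlation with the response to the noise has density `Φ_A(t,·) σ g`: the correlations solve
`c' = A c + (σ g - A c)`, to which variation of constants applies. -/
theorem IsNoise.integral_mul_noiseResponse [IsProbabilityMeasure P] (hM : IsNoise P ℱ T σ M)
    (hp : IsPropagator T A Ψ Z) (hA : IsLinfty T A) {r t : ℝ} (hr : r ∈ Icc 0 T)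
    (ht : t ∈ Icc 0 T) (hrt : r ≤ t) {η : Ω → ℝ} (hη : MemLp η 2 P) {g : ℝ → ℝ}
    (hg : ∀ j, IntegrableOn (fun u => σ u j * g u) (Icc 0 T))
    (hηM : ∀ s ∈ Icc r t, ∀ j,
      ∫ ω, η ω * (M s ω j - M r ω j) ∂P = ∫ u in r..s, σ u j * g u) (i : Fin n) :
    ∫ ω, η ω * noiseResponse A Ψ Z M r t ω i ∂P =
      ∫ u in r..t, ((Ψ t * Z u) *ᵥ σ u) i * g u := by
  let c : ℝ → Fin n → ℝ := fun s j => ∫ u in r..s, σ u j * g u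
  have hc : ∀ j, IsPrimitiveOn T (fun s => c s j) (fun u => σ u j * g u) := fun j =>
    IsPrimitiveOn.of_integrableOn (hg j) hr
  have hy : ∀ j, IsPrimitiveOn T (fun s => c s j)
      (fun s => (A s *ᵥ c s) j + (g s • σ s - A s *ᵥ c s) j) := fun j =>
    (hc j).congr (fun _ _ => rfl) (Eventually.of_forall fun s => by
      simp only [Pi.sub_apply, Pi.smul_apply, smul_eq_mul]; ring)
  have hΦ : IsLinfty T (fun s => Ψ t * Z s) := (IsLinfty.const (Ψ t)).mul hp.isLinfty_inv
  have voc := hp.variation_of_constants hy hr ht i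
  have hcr : c r = 0 := by ext j; simp [c]
  rw [hcr, Matrix.mulVec_zero, Pi.zero_apply, zero_add] at voc
  have i1 : IntervalIntegrable (fun s => ((Ψ t * Z s) *ᵥ (g s • σ s)) i) volume r t :=
    intervalIntegrable_of_integrableOn_Icc (hΦ.mulVec_integrableOn (fun j => by
      simpa only [Pi.smul_apply, smul_eq_mul, mul_comm] using hg j) i) hr ht
  have i2 : IntervalIntegrable (fun s => ((Ψ t * Z s) *ᵥ (A s *ᵥ c s)) i) volume r t :=
    intervalIntegrable_of_integrableOn_Icc (hΦ.mulVec_integrableOn (hA.mulVec_integrableOn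
      fun j => integrableOn_of_continuousOn (hc j).continuousOn) i) hr ht
  simp only [Matrix.mulVec_sub, Pi.sub_apply] at voc
  rw [intervalIntegral.integral_sub i1 i2] at voc
  have hN : ∀ s ∈ Icc r t, ∀ j, MemLp (fun ω => (M s ω - M r ω) j) 2 P := fun s hs j =>
    (hM.memLp_time s ⟨hr.1.trans hs.1, hs.2.trans ht.2⟩ j).sub (hM.memLp_time r hr j)
  have e1 : ∫ ω, η ω * noiseResponse A Ψ Z M r t ω i ∂P =
      c t i + ∫ s in r..t, ((Ψ t * Z s) *ᵥ (A s *ᵥ c s)) i := by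
    have hL := memLp_interval_primitive
      (f := fun s ω => ((Ψ t * Z s) *ᵥ (A s *ᵥ (M s ω - M r ω))) i)
      (hM.memLp_response_integrand hp hA hr i) hr ht
    have j1 : Integrable (fun ω => η ω * (M t ω i - M r ω i)) P :=
      hη.integrable_mul (hN t ⟨hrt, le_rfl⟩ i)
    have j2 : Integrable (fun ω =>
        η ω * ∫ s in r..t, ((Ψ t * Z s) *ᵥ (A s *ᵥ (M s ω - M r ω))) i) P :=
      hη.integrable_mul hL
    simp only [noiseResponse, mul_add]
    rw [integral_add j1 j2,
      hηM t ⟨hrt, le_rfl⟩ i, integral_mul_primitive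
        (f := fun s ω => ((Ψ t * Z s) *ᵥ (A s *ᵥ (M s ω - M r ω))) i)
        (hM.memLp_response_integrand hp hA hr i) hη hr ht hrt]
    congr 1
    refine intervalIntegral.integral_congr fun s hs => ?_
    rw [uIcc_of_le hrt] at hs
    rw [integral_mul_mulVec _ hη (fun j => memLp_mulVec_const _ (hN s hs) j)]
    have : (fun j => ∫ ω, η ω * (A s *ᵥ (M s ω - M r ω)) j ∂P) = A s *ᵥ c s := by
      ext j
      rw [integral_mul_mulVec _ hη (hN s hs)]
      have : (fun k => ∫ ω, η ω * (M s ω - M r ω) k ∂P) = c s := by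
        ext k
        exact hηM s hs k
      rw [this]
    rw [this]
  rw [e1, voc, sub_add_cancel]
  refine intervalIntegral.integral_congr fun s _ => ?_
  simp only [Matrix.mulVec_smul, Pi.smul_apply, smul_eq_mul, mul_comm]

/-- The covariance matrix of the response to the noise. -/
theorem IsNoise.integral_noiseResponse_mul_noiseResponse [IsProbabilityMeasure P]
    (hM : IsNoise P ℱ T σ M) (hp : IsPropagator T A Ψ Z) (hA : IsLinfty T A)
    (hσ : IsLinftyVec T σ) {r t : ℝ} (hr : r ∈ Icc 0 T) (ht : t ∈ Icc 0 T) (hrt : r ≤ t)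
    (i j : Fin n) :
    ∫ ω, noiseResponse A Ψ Z M r t ω i * noiseResponse A Ψ Z M r t ω j ∂P =
      ∫ u in r..t, ((Ψ t * Z u) *ᵥ σ u) j * ((Ψ t * Z u) *ᵥ σ u) i := by
  have hΦ : IsLinfty T (fun s => Ψ t * Z s) := (IsLinfty.const (Ψ t)).mul hp.isLinfty_inv
  have hσi : ∀ k, IntegrableOn (fun u => σ u k) (Icc 0 T) := fun k => (hσ k).integrable le_top
  have hΦσ := hΦ.mulVec_integrableOn hσi
  refine hM.integral_mul_noiseResponse hp hA hr ht hrt (hM.memLp_noiseResponse hp hA hr ht i)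
    (fun k => integrable_memLp_top_mul (hσ k) (hΦσ i)) (fun s hs k => ?_) j
  have hs' : s ∈ Icc 0 T := ⟨hr.1.trans hs.1, hs.2.trans ht.2⟩
  -- the moment formula for `η = M_k(s) - M_k(r)`, whose density `g` is `σ_k` cut off at `s`
  have key := hM.integral_mul_noiseResponse hp hA hr ht hrt
    (η := fun ω => M s ω k - M r ω k) ((hM.memLp_time s hs' k).sub (hM.memLp_time r hr k))
    (g := (Ioc r s).indicator fun u => σ u k)
    (fun l => integrable_memLp_top_mul (hσ l) ((hσi k).indicator measurableSet_Ioc))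
    (fun s' hs'' l => hM.integral_sub_mul_sub r hr s' ⟨hr.1.trans hs''.1, hs''.2.trans ht.2⟩ s hs'
      hs''.1 hs.1 l k) i
  have e : ∫ u in r..t, ((Ψ t * Z u) *ᵥ σ u) i * (Ioc r s).indicator (fun u => σ u k) u =
      ∫ u in r..s, σ u k * ((Ψ t * Z u) *ᵥ σ u) i := by
    rw [intervalIntegral.integral_of_le hrt, intervalIntegral.integral_of_le hs.1,
      ← integral_indicator measurableSet_Ioc, ← integral_indicator measurableSet_Ioc]
    congr 1 with u
    simp only [indicator_apply, mem_Ioc]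
    by_cases h1 : r < u
    · by_cases h2 : u ≤ s
      · simp [h1, h2, h2.trans hs.2, mul_comm]
      · simp [h1, h2]
    · simp [h1]
  rw [← e, ← key]
  simp only [mul_comm]

/-- Variation of constants for the solution, with the noise integrated by parts. -/
theorem IsSolution.ae_eq_add_noiseResponse [IsProbabilityMeasure P]
    (hX : IsSolution P ℱ W T h A B σ U X) (hp : IsPropagator T A Ψ Z) (hA : IsLinfty T A)
    (hB : IsLinfty T B) (hU : IsL2Adapted T P ℱ U) (hh : 0 ≤ h) :
    ∀ᵐ ω ∂P, ∀ r ∈ Icc 0 T, ∀ t ∈ Icc 0 T, ∀ i,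
      X t ω i = ((Ψ t * Z r) *ᵥ X r ω) i +
        (∫ s in r..t, ((Ψ t * Z s) *ᵥ (B s *ᵥ zeroHistory U (s - h) ω)) i) +
        noiseResponse A Ψ Z (noise h A B U X) r t ω i := by
  filter_upwards [hX.ae_drift_integrableOn hA hB hU hh, hX.ae_continuousOn,
    ae_zeroHistory_integrableOn hU hh] with ω hd hXc hu r hr t ht i
  have h0 : (0 : ℝ) ∈ Icc 0 T := ⟨le_rfl, hr.1.trans hr.2⟩
  set N : ℝ → Fin n → ℝ := fun s => noise h A B U X s ω - noise h A B U X r ω with hN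
  have hNc : ∀ j, ContinuousOn (fun s => N s j) (Icc 0 T) := fun j =>
    ((hXc j).sub (IsPrimitiveOn.of_integrableOn (hd j) h0).continuousOn).sub continuousOn_const
  -- `X - (M - M(r))` is absolutely continuous and agrees with `X` at time `r`
  have hy : ∀ j, IsPrimitiveOn T (fun s => (X s ω - N s) j)
      (fun s => (A s *ᵥ (X s ω - N s)) j +
        (B s *ᵥ zeroHistory U (s - h) ω + A s *ᵥ N s) j) := fun j => by
    refine ((IsPrimitiveOn.of_integrableOn (hd j) h0).add
      (IsPrimitiveOn.const T (noise h A B U X r ω j))).congr (fun s _ => ?_)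
      (Eventually.of_forall fun s => ?_)
    · simp only [hN, noise, Pi.sub_apply]
      ring
    · simp only [Matrix.mulVec_sub, drift, Pi.sub_apply, Pi.add_apply]
      ring
  have hΦ : IsLinfty T (fun s => Ψ t * Z s) := (IsLinfty.const (Ψ t)).mul hp.isLinfty_inv
  have voc := hp.variation_of_constants hy hr ht i
  have hNr : N r = 0 := by simp [hN]
  simp only [Matrix.mulVec_add, Pi.add_apply] at voc
  rw [intervalIntegral.integral_add
    (intervalIntegrable_of_integrableOn_Icc (hΦ.mulVec_integrableOn
      (hB.mulVec_integrableOn hu) i) hr ht)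
    (intervalIntegrable_of_integrableOn_Icc (hΦ.mulVec_integrableOn (hA.mulVec_integrableOn
      fun j => integrableOn_of_continuousOn (hNc j)) i) hr ht), hNr, sub_zero] at voc
  have e : X t ω i = (X t ω - N t) i + N t i := by simp
  rw [e, voc]
  simp only [noiseResponse, hN, Pi.sub_apply]
  ring

end

/-! ### The solution in terms of the Artstein transform -/

section

variable {Ω : Type*} {mΩ : MeasurableSpace Ω} {P : Measure Ω}
  {ℱ : Filtration ℝ≥0 mΩ} {W : ℝ≥0 → Ω → ℝ} {n m : ℕ} {T h : ℝ}
  {A : ℝ → Matrix (Fin n) (Fin n) ℝ} {B : ℝ → Matrix (Fin n) (Fin m) ℝ} {σ : ℝ → Fin n → ℝ}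
  {U : ℝ → Ω → Fin m → ℝ} {X : ℝ → Ω → Fin n → ℝ} {M : ℝ → Ω → Fin n → ℝ}
  {Ψ Z : ℝ → Matrix (Fin n) (Fin n) ℝ}

theorem integral_mulVec_mulVec {k : ℕ} (N : Matrix (Fin k) (Fin n) ℝ) {v : ℝ → Fin n → ℝ} {r t : ℝ}
    (hv : ∀ j, IntervalIntegrable (fun s => (Z s *ᵥ v s) j) volume r t) (i : Fin k) :
    ∫ s in r..t, ((N * Z s) *ᵥ v s) i = (N *ᵥ fun j => ∫ s in r..t, (Z s *ᵥ v s) j) i := by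
  simp only [← Matrix.mulVec_mulVec]
  change ∫ s in r..t, ∑ j, N i j * (Z s *ᵥ v s) j = ∑ j, N i j * _
  rw [intervalIntegral.integral_finsetSum fun j _ => (hv j).const_mul _]
  simp only [intervalIntegral.integral_const_mul]

theorem measurePreserving_add_Icc (T h : ℝ) :
    MeasurePreserving (fun s : ℝ => s + h) (volume.restrict (Icc 0 (T - h)))
      (volume.restrict (Icc h T)) := by
  have := (measurePreserving_add_right volume h).restrict_preimage
    (measurableSet_Icc (a := h) (b := T))
  convert this using 2
  ext s
  simp [le_sub_iff_add_le]

theorem memLp_shift {p : ℝ≥0∞} (hh : 0 ≤ h) {f : ℝ → ℝ}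
    (hf : MemLp f p (volume.restrict (Icc 0 T))) :
    MemLp (fun s => f (s + h)) p (volume.restrict (Icc 0 (T - h))) :=
  (hf.mono_measure (Measure.restrict_mono (Icc_subset_Icc hh le_rfl) le_rfl)).comp_measurePreserving
    (measurePreserving_add_Icc T h)

theorem memLp_timeProd_shift [IsProbabilityMeasure P] (hh : 0 ≤ h) {f : ℝ → Ω → ℝ}
    (hf : MemLp (fun p : ℝ × Ω => f p.1 p.2) 2 (timeProd T P)) :
    MemLp (fun p : ℝ × Ω => f (p.1 + h) p.2) 2 (timeProd (T - h) P) :=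
  (memLp_timeProd_mono hf (Icc_subset_Icc hh le_rfl)).comp_measurePreserving
    ((measurePreserving_add_Icc T h).prod (MeasurePreserving.id P))

/-- The integrand `Ψ(s)⁻¹ B(s) U(s - h)` of the control terms is square integrable. -/
theorem IsPropagator.memLp_control [IsProbabilityMeasure P] (hp : IsPropagator T A Ψ Z)
    (hB : IsLinfty T B) (hU : IsL2Adapted T P ℱ U) (hh : 0 ≤ h) (j : Fin n) :
    MemLp (fun p : ℝ × Ω => (Z p.1 *ᵥ (B p.1 *ᵥ zeroHistory U (p.1 - h) p.2)) j) 2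
      (timeProd T P) :=
  hp.isLinfty_inv.memLp_mulVec (v := fun s ω => B s *ᵥ zeroHistory U (s - h) ω)
    (hB.memLp_mulVec (v := fun s ω => zeroHistory U (s - h) ω) fun l => hU.memLp_zeroHistory hh l) j

theorem IsPropagator.ae_control_integrableOn [IsProbabilityMeasure P] (hp : IsPropagator T A Ψ Z)
    (hB : IsLinfty T B) (hU : IsL2Adapted T P ℱ U) (hh : 0 ≤ h) :
    ∀ᵐ ω ∂P, ∀ j, IntegrableOn (fun s => (Z s *ᵥ (B s *ᵥ zeroHistory U (s - h) ω)) j)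
      (Icc 0 T) :=
  ae_all_iff.2 fun j => ae_integrableOn_slice
    (f := fun s ω => (Z s *ᵥ (B s *ᵥ zeroHistory U (s - h) ω)) j) (hp.memLp_control hB hU hh j)

/-- Variation of constants from time `0`. -/
theorem IsSolution.ae_eq_of_zero [IsProbabilityMeasure P]
    (hX : IsSolution P ℱ W T h A B σ U X) (hp : IsPropagator T A Ψ Z) (hA : IsLinfty T A)
    (hB : IsLinfty T B) (hU : IsL2Adapted T P ℱ U) (hh : 0 ≤ h) (hT : 0 ≤ T)
    (hM : IsNoise P ℱ T σ (noise h A B U X)) :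
    ∀ᵐ ω ∂P, ∀ t ∈ Icc 0 T, ∀ i, X t ω i =
      (Ψ t *ᵥ fun j => ∫ s in (0 : ℝ)..t, (Z s *ᵥ (B s *ᵥ zeroHistory U (s - h) ω)) j) i +
      (noise h A B U X t ω i - noise h A B U X 0 ω i +
        (Ψ t *ᵥ fun j => ∫ s in (0 : ℝ)..t,
          (Z s *ᵥ (A s *ᵥ (noise h A B U X s ω - noise h A B U X 0 ω))) j) i) := by
  have h0 : (0 : ℝ) ∈ Icc 0 T := ⟨le_rfl, hT⟩
  have hn : ∀ᵐ ω ∂P, ∀ j, IntegrableOn (fun s =>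
      (Z s *ᵥ (A s *ᵥ (noise h A B U X s ω - noise h A B U X 0 ω))) j) (Icc 0 T) :=
    ae_all_iff.2 fun j => ae_integrableOn_slice
      (f := fun s ω => (Z s *ᵥ (A s *ᵥ (noise h A B U X s ω - noise h A B U X 0 ω))) j)
      (hp.isLinfty_inv.memLp_mulVec
        (v := fun s ω => A s *ᵥ (noise h A B U X s ω - noise h A B U X 0 ω))
        (hA.memLp_mulVec (v := fun s ω => noise h A B U X s ω - noise h A B U X 0 ω)
          (hM.memLp_sub h0)) j)
  filter_upwards [hX.ae_eq_add_noiseResponse hp hA hB hU hh, hX.initial,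
    hp.ae_control_integrableOn hB hU hh, hn] with ω h1 h2 h3 h4 t ht i
  rw [h1 0 h0 t ht i, h2, Matrix.mulVec_zero, Pi.zero_apply, zero_add, noiseResponse,
    integral_mulVec_mulVec _ fun j => intervalIntegrable_of_integrableOn_Icc (h3 j) h0 ht,
    integral_mulVec_mulVec _ fun j => intervalIntegrable_of_integrableOn_Icc (h4 j) h0 ht]

theorem IsSolution.memLp_time [IsProbabilityMeasure P]
    (hX : IsSolution P ℱ W T h A B σ U X) (hp : IsPropagator T A Ψ Z) (hA : IsLinfty T A)
    (hB : IsLinfty T B) (hU : IsL2Adapted T P ℱ U) (hh : 0 ≤ h) (hT : 0 ≤ T)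
    (hM : IsNoise P ℱ T σ (noise h A B U X)) {t : ℝ} (ht : t ∈ Icc 0 T) (i : Fin n) :
    MemLp (fun ω => X t ω i) 2 P := by
  have h0 : (0 : ℝ) ∈ Icc 0 T := ⟨le_rfl, hT⟩
  refine (memLp_congr_ae ((hX.ae_eq_of_zero hp hA hB hU hh hT hM).mono
    fun ω hω => hω t ht i)).2 ?_
  refine (memLp_mulVec_const _ (fun j => ?_) i).add
    (((hM.memLp_time t ht i).sub (hM.memLp_time 0 h0 i)).add
      (memLp_mulVec_const _ (fun j => ?_) i))
  · exact memLp_primitive (f := fun s ω => (Z s *ᵥ (B s *ᵥ zeroHistory U (s - h) ω)) j)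
      (hp.memLp_control hB hU hh j) ht
  · exact memLp_primitive
      (f := fun s ω => (Z s *ᵥ (A s *ᵥ (noise h A B U X s ω - noise h A B U X 0 ω))) j)
      (hp.isLinfty_inv.memLp_mulVec
        (v := fun s ω => A s *ᵥ (noise h A B U X s ω - noise h A B U X 0 ω))
        (hA.memLp_mulVec (v := fun s ω => noise h A B U X s ω - noise h A B U X 0 ω)
          (hM.memLp_sub h0)) j) ht

theorem IsSolution.memLp [IsProbabilityMeasure P]
    (hX : IsSolution P ℱ W T h A B σ U X) (hp : IsPropagator T A Ψ Z) (hA : IsLinfty T A)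
    (hB : IsLinfty T B) (hU : IsL2Adapted T P ℱ U) (hh : 0 ≤ h) (hT : 0 ≤ T)
    (hM : IsNoise P ℱ T σ (noise h A B U X)) (i : Fin n) :
    MemLp (fun p : ℝ × Ω => X p.1 p.2 i) 2 (timeProd T P) := by
  have h0 : (0 : ℝ) ∈ Icc 0 T := ⟨le_rfl, hT⟩
  have h1 := hp.isLinfty.memLp_mulVec (P := P)
    (v := fun t ω j => ∫ s in (0 : ℝ)..t, (Z s *ᵥ (B s *ᵥ zeroHistory U (s - h) ω)) j)
    (fun j => memLp_timeProd_primitive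
      (f := fun s ω => (Z s *ᵥ (B s *ᵥ zeroHistory U (s - h) ω)) j)
      (hp.memLp_control hB hU hh j) hT) i
  have h2 := hp.isLinfty.memLp_mulVec (P := P)
    (v := fun t ω j => ∫ s in (0 : ℝ)..t,
      (Z s *ᵥ (A s *ᵥ (noise h A B U X s ω - noise h A B U X 0 ω))) j)
    (fun j => memLp_timeProd_primitive
      (f := fun s ω => (Z s *ᵥ (A s *ᵥ (noise h A B U X s ω - noise h A B U X 0 ω))) j)
      (hp.isLinfty_inv.memLp_mulVec
        (v := fun s ω => A s *ᵥ (noise h A B U X s ω - noise h A B U X 0 ω))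
        (hA.memLp_mulVec (v := fun s ω => noise h A B U X s ω - noise h A B U X 0 ω)
          (hM.memLp_sub h0)) j) hT) i
  refine (memLp_congr_ae ?_).2 (h1.add ((hM.memLp_sub h0 i).add h2))
  filter_upwards [ae_prod_of_ae (ae_restrict_mem (μ := volume) (s := Icc 0 T) measurableSet_Icc)
    (hX.ae_eq_of_zero hp hA hB hU hh hT hM)] with p hp
  exact hp.2 p.1 hp.1 i

/-- The substitution `s ↦ s - h` in the Artstein transform. -/
theorem ae_artstein_eq [IsProbabilityMeasure P] (hp : IsPropagator T A Ψ Z)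
    (hΦ : ∀ t ∈ Icc 0 T, ∀ s ∈ Icc 0 T, fundamentalMatrix T A t s = Ψ t * Z s)
    (hB : IsLinfty T B) (hU : IsL2Adapted T P ℱ U) (hh : 0 ≤ h) (X : ℝ → Ω → Fin n → ℝ) :
    ∀ᵐ ω ∂P, ∀ r ∈ Icc 0 (T - h), artstein T h A B U X r ω =
      X r ω + Ψ r *ᵥ fun j => ∫ s in r..(r + h),
        (Z s *ᵥ (B s *ᵥ zeroHistory U (s - h) ω)) j := by
  filter_upwards [hp.ae_control_integrableOn hB hU hh] with ω hω r hr
  have hr' : r ∈ Icc 0 T := ⟨hr.1, by linarith [hr.2]⟩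
  have ht' : r + h ∈ Icc 0 T := ⟨by linarith [hr.1], by linarith [hr.2]⟩
  have hrt : r ≤ r + h := by linarith
  have e1 := intervalIntegral.integral_comp_add_right (a := r - h) (b := r)
    (fun s => (fundamentalMatrix T A r s * B s) *ᵥ zeroHistory U (s - h) ω) h
  simp only [add_sub_cancel_right, sub_add_cancel] at e1
  rw [artstein, e1]
  congr 1
  have e2 : ∫ s in r..(r + h), (fundamentalMatrix T A r s * B s) *ᵥ zeroHistory U (s - h) ω =
      ∫ s in r..(r + h), (Ψ r * Z s) *ᵥ (B s *ᵥ zeroHistory U (s - h) ω) := by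
    refine intervalIntegral.integral_congr fun s hs => ?_
    rw [uIcc_of_le hrt] at hs
    rw [hΦ r hr' s ⟨hr'.1.trans hs.1, hs.2.trans ht'.2⟩, Matrix.mulVec_mulVec]
  rw [e2]
  ext i
  rw [← integral_mulVec_mulVec _ fun j => intervalIntegrable_of_integrableOn_Icc (hω j) hr' ht',
    intervalIntegral.integral_of_le hrt, intervalIntegral.integral_of_le hrt]
  refine eval_integral (fun j => ?_) i
  have : IntegrableOn (fun s => ((Ψ r * Z s) *ᵥ (B s *ᵥ zeroHistory U (s - h) ω)) j) (Icc 0 T) := by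
    simp only [← Matrix.mulVec_mulVec _ (Ψ r)]
    exact (IsLinfty.const (Ψ r)).mulVec_integrableOn hω j
  exact this.mono_set (Ioc_subset_Icc_self.trans (Icc_subset_Icc hr.1 ht'.2))

/-- The solution at time `r + h` is the propagated Artstein transform at time `r`, plus the response
to the noise on `[r, r + h]`. -/
theorem IsSolution.ae_eq_artstein_add [IsProbabilityMeasure P]
    (hX : IsSolution P ℱ W T h A B σ U X) (hp : IsPropagator T A Ψ Z)
    (hΦ : ∀ t ∈ Icc 0 T, ∀ s ∈ Icc 0 T, fundamentalMatrix T A t s = Ψ t * Z s)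
    (hA : IsLinfty T A) (hB : IsLinfty T B) (hU : IsL2Adapted T P ℱ U) (hh : 0 ≤ h) :
    ∀ᵐ ω ∂P, ∀ r ∈ Icc 0 (T - h), ∀ i, X (r + h) ω i =
      ((Ψ (r + h) * Z r) *ᵥ artstein T h A B U X r ω) i +
        noiseResponse A Ψ Z (noise h A B U X) r (r + h) ω i := by
  filter_upwards [hX.ae_eq_add_noiseResponse hp hA hB hU hh, ae_artstein_eq hp hΦ hB hU hh X,
    hp.ae_control_integrableOn hB hU hh] with ω h1 h2 h3 r hr i
  have hr' : r ∈ Icc 0 T := ⟨hr.1, by linarith [hr.2]⟩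
  have ht' : r + h ∈ Icc 0 T := ⟨by linarith [hr.1], by linarith [hr.2]⟩
  rw [h1 r hr' (r + h) ht' i, h2 r hr,
    integral_mulVec_mulVec _ fun j => intervalIntegrable_of_integrableOn_Icc (h3 j) hr' ht',
    Matrix.mulVec_add, Matrix.mulVec_mulVec, Matrix.mul_assoc, hp.inv_mul r hr', Matrix.mul_one,
    Pi.add_apply]

theorem memLp_artstein_time [IsProbabilityMeasure P] (hp : IsPropagator T A Ψ Z)
    (hΦ : ∀ t ∈ Icc 0 T, ∀ s ∈ Icc 0 T, fundamentalMatrix T A t s = Ψ t * Z s)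
    (hB : IsLinfty T B) (hU : IsL2Adapted T P ℱ U) (hh : 0 ≤ h)
    (hX : ∀ t ∈ Icc 0 T, ∀ i, MemLp (fun ω => X t ω i) 2 P) {r : ℝ} (hr : r ∈ Icc 0 (T - h))
    (i : Fin n) : MemLp (fun ω => artstein T h A B U X r ω i) 2 P := by
  have hr' : r ∈ Icc 0 T := ⟨hr.1, by linarith [hr.2]⟩
  have ht' : r + h ∈ Icc 0 T := ⟨by linarith [hr.1], by linarith [hr.2]⟩
  refine (memLp_congr_ae ((ae_artstein_eq hp hΦ hB hU hh X).mono
    fun ω hω => congrFun (hω r hr) i)).2 ?_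
  exact (hX r hr' i).add (memLp_mulVec_const _ (fun j => memLp_interval_primitive
    (f := fun s ω => (Z s *ᵥ (B s *ᵥ zeroHistory U (s - h) ω)) j)
    (hp.memLp_control hB hU hh j) hr' ht') i)

theorem memLp_artstein [IsProbabilityMeasure P] (hp : IsPropagator T A Ψ Z)
    (hΦ : ∀ t ∈ Icc 0 T, ∀ s ∈ Icc 0 T, fundamentalMatrix T A t s = Ψ t * Z s)
    (hB : IsLinfty T B) (hU : IsL2Adapted T P ℱ U) (hh : 0 ≤ h) (hT : 0 ≤ T)
    (hX : ∀ i, MemLp (fun p : ℝ × Ω => X p.1 p.2 i) 2 (timeProd T P)) (i : Fin n) :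
    MemLp (fun p : ℝ × Ω => artstein T h A B U X p.1 p.2 i) 2 (timeProd (T - h) P) := by
  have h0 : (0 : ℝ) ∈ Icc 0 T := ⟨le_rfl, hT⟩
  have hsub : Icc 0 (T - h) ⊆ Icc 0 T := Icc_subset_Icc le_rfl (by linarith)
  have hprim := fun j => memLp_timeProd_primitive (P := P)
    (f := fun s ω => (Z s *ᵥ (B s *ᵥ zeroHistory U (s - h) ω)) j) (hp.memLp_control hB hU hh j) hT
  have hΨ : IsLinfty (T - h) Ψ := fun i j =>
    (hp.isLinfty i j).mono_measure (Measure.restrict_mono hsub le_rfl)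
  have h1 := hΨ.memLp_mulVec (P := P)
    (v := fun t ω j => (∫ s in (0 : ℝ)..(t + h), (Z s *ᵥ (B s *ᵥ zeroHistory U (s - h) ω)) j) -
      ∫ s in (0 : ℝ)..t, (Z s *ᵥ (B s *ᵥ zeroHistory U (s - h) ω)) j)
    (fun j => (memLp_timeProd_shift (f := fun t ω => ∫ s in (0 : ℝ)..t,
      (Z s *ᵥ (B s *ᵥ zeroHistory U (s - h) ω)) j) hh (hprim j)).sub
      (memLp_timeProd_mono (f := fun t ω => ∫ s in (0 : ℝ)..t,
        (Z s *ᵥ (B s *ᵥ zeroHistory U (s - h) ω)) j) (hprim j) hsub)) i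
  refine (memLp_congr_ae ?_).2
    ((memLp_timeProd_mono (f := fun t ω => X t ω i) (hX i) hsub).add h1)
  filter_upwards [ae_prod_of_ae (ae_restrict_mem (μ := volume) (s := Icc 0 (T - h))
    measurableSet_Icc) ((ae_artstein_eq hp hΦ hB hU hh X).and
      (hp.ae_control_integrableOn hB hU hh))] with p hp
  obtain ⟨ht, h2, h3⟩ := hp
  have ht' : p.1 + h ∈ Icc 0 T := ⟨by linarith [ht.1], by linarith [ht.2]⟩
  rw [h2 p.1 ht]
  simp only [Pi.add_apply]
  congr 3
  ext j
  exact (intervalIntegral.integral_interval_sub_left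
    (intervalIntegrable_of_integrableOn_Icc (h3 j) h0 ht')
    (intervalIntegrable_of_integrableOn_Icc (h3 j) h0 (hsub ht))).symm

/-- The Artstein transform at time `r` is uncorrelated with the noise after `r`, since the control
enters it only up to time `r`. -/
theorem IsSolution.integral_artstein_mul_noise_sub [IsProbabilityMeasure P]
    (hX : IsSolution P ℱ W T h A B σ U X) (hp : IsPropagator T A Ψ Z)
    (hΦ : ∀ t ∈ Icc 0 T, ∀ s ∈ Icc 0 T, fundamentalMatrix T A t s = Ψ t * Z s)
    (hB : IsLinfty T B) (hU : IsL2Adapted T P ℱ U) (hh : 0 ≤ h) (hM : IsNoise P ℱ T σ M)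
    (hX2 : ∀ t ∈ Icc 0 T, ∀ i, MemLp (fun ω => X t ω i) 2 P)
    {r s : ℝ} (hr : r ∈ Icc 0 (T - h)) (hs : s ∈ Icc 0 T) (hrs : r ≤ s) (i j : Fin n) :
    ∫ ω, artstein T h A B U X r ω i * (M s ω j - M r ω j) ∂P = 0 := by
  have hr' : r ∈ Icc 0 T := ⟨hr.1, by linarith [hr.2]⟩
  have ht' : r + h ∈ Icc 0 T := ⟨by linarith [hr.1], by linarith [hr.2]⟩
  have hrt : r ≤ r + h := by linarith
  set η : Ω → ℝ := fun ω => M s ω j - M r ω j with hη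
  have hη2 : MemLp η 2 P := (hM.memLp_time s hs j).sub (hM.memLp_time r hr' j)
  let p : Ω → Fin n → ℝ := fun ω k =>
    ∫ u in r..(r + h), (Z u *ᵥ (B u *ᵥ zeroHistory U (u - h) ω)) k
  have hp2 : ∀ k, MemLp (fun ω => p ω k) 2 P := fun k => memLp_interval_primitive
    (f := fun s ω => (Z s *ᵥ (B s *ᵥ zeroHistory U (s - h) ω)) k)
    (hp.memLp_control hB hU hh k) hr' ht'
  have e1 : ∫ ω, artstein T h A B U X r ω i * η ω ∂P =
      ∫ ω, (X r ω i * η ω + η ω * (Ψ r *ᵥ p ω) i) ∂P := by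
    refine integral_congr_ae ?_
    filter_upwards [ae_artstein_eq hp hΦ hB hU hh X] with ω hω
    rw [hω r hr, Pi.add_apply]
    ring
  have e2 : ∀ k, ∫ ω, η ω * p ω k ∂P = 0 := fun k => by
    rw [integral_mul_primitive (f := fun s ω => (Z s *ᵥ (B s *ᵥ zeroHistory U (s - h) ω)) k)
      (hp.memLp_control hB hU hh k) hη2 hr' ht' hrt]
    have hU2 : ∀ᵐ u ∂(volume.restrict (Icc 0 T)), ∀ l,
        MemLp (fun ω => zeroHistory U (u - h) ω l) 2 P := ae_all_iff.2 fun l =>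
      ae_memLp_slice_left (f := fun u ω => zeroHistory U (u - h) ω l) (hU.memLp_zeroHistory hh l)
    refine intervalIntegral.integral_zero_ae ?_
    filter_upwards [(ae_restrict_iff' measurableSet_Icc).1 hU2] with u hu hut
    rw [uIoc_of_le hrt] at hut
    have hu' : u ∈ Icc 0 T := ⟨hr.1.trans hut.1.le, hut.2.trans ht'.2⟩
    rw [integral_mul_mulVec _ hη2 (memLp_mulVec_const _ (hu hu'))]
    have : (fun l => ∫ ω, η ω * (B u *ᵥ zeroHistory U (u - h) ω) l ∂P) = 0 := by
      ext l
      rw [integral_mul_mulVec _ hη2 (hu hu')]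
      have : (fun q => ∫ ω, η ω * zeroHistory U (u - h) ω q ∂P) = 0 := by
        ext q
        simp only [mul_comm (η _)]
        exact hM.integral_mul_sub r hr' s hs hrs _
          (hU.stronglyMeasurable_zeroHistory hu' hh (by linarith [hut.2]) q) (hu hu' q) j
      rw [this, Matrix.mulVec_zero]
    rw [this, Matrix.mulVec_zero, Pi.zero_apply]
  have j1 : Integrable (fun ω => X r ω i * η ω) P := (hX2 r hr' i).integrable_mul hη2
  have j2 : Integrable (fun ω => η ω * (Ψ r *ᵥ p ω) i) P :=
    hη2.integrable_mul (memLp_mulVec_const _ hp2 i)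
  rw [e1, integral_add j1 j2, integral_mul_mulVec _ hη2 hp2]
  simp only [e2]
  rw [hM.integral_mul_sub r hr' s hs hrs _
    ((continuous_apply i).comp_stronglyMeasurable (hX.adapted r hr')) (hX2 r hr' i) j]
  have : (fun _ : Fin n => (0 : ℝ)) = 0 := rfl
  rw [this, Matrix.mulVec_zero, Pi.zero_apply, zero_add]

end

section

variable {Ω : Type*} {mΩ : MeasurableSpace Ω} {P : Measure Ω}
  {ℱ : Filtration ℝ≥0 mΩ} {W : ℝ≥0 → Ω → ℝ} {n m : ℕ} {T h : ℝ}
  {A : ℝ → Matrix (Fin n) (Fin n) ℝ} {B : ℝ → Matrix (Fin n) (Fin m) ℝ} {σ : ℝ → Fin n → ℝ}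
  {U : ℝ → Ω → Fin m → ℝ} {X : ℝ → Ω → Fin n → ℝ} {Ψ Z : ℝ → Matrix (Fin n) (Fin n) ℝ}

/-! ### Quadratic forms -/

theorem quadForm_eq_sum {k : ℕ} (S : Matrix (Fin k) (Fin k) ℝ) (v : Fin k → ℝ) :
    quadForm S v = ∑ i, ∑ j, S i j * (v i * v j) := by
  simp only [quadForm, dotProduct, Matrix.mulVec, Finset.mul_sum]
  refine Finset.sum_congr rfl fun i _ => Finset.sum_congr rfl fun j _ => ?_
  ring

theorem quadForm_transpose_mul_mul {k : ℕ} (S Φ : Matrix (Fin k) (Fin k) ℝ) (v : Fin k → ℝ) :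
    quadForm (Φᵀ * S * Φ) v = quadForm S (Φ *ᵥ v) := by
  rw [quadForm, quadForm, ← Matrix.mulVec_mulVec, ← Matrix.mulVec_mulVec, Matrix.dotProduct_mulVec,
    Matrix.vecMul_transpose]

theorem quadForm_nonneg {k : ℕ} {S : Matrix (Fin k) (Fin k) ℝ} (hS : S.PosSemidef)
    (v : Fin k → ℝ) : 0 ≤ quadForm S v := by
  simpa [quadForm] using hS.dotProduct_mulVec_nonneg v

theorem posSemidef_transpose_mul_mul {k : ℕ} {S : Matrix (Fin k) (Fin k) ℝ} (hS : S.PosSemidef)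
    (Φ : Matrix (Fin k) (Fin k) ℝ) : (Φᵀ * S * Φ).PosSemidef := by
  rw [← Matrix.conjTranspose_eq_transpose_of_trivial]
  exact hS.conjTranspose_mul_mul_same Φ

theorem integrable_quadForm {k : ℕ} (S : Matrix (Fin k) (Fin k) ℝ) {v : Ω → Fin k → ℝ}
    (hv : ∀ i, MemLp (fun ω => v ω i) 2 P) : Integrable (fun ω => quadForm S (v ω)) P := by
  simp only [quadForm_eq_sum]
  exact integrable_finsetSum _ fun i _ => integrable_finsetSum _ fun j _ =>
    ((hv i).integrable_mul (hv j)).const_mul _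

theorem IsLinfty.integrable_quadForm [IsProbabilityMeasure P] {k : ℕ}
    {S : ℝ → Matrix (Fin k) (Fin k) ℝ} (hS : IsLinfty T S) {v : ℝ → Ω → Fin k → ℝ}
    (hv : ∀ i, MemLp (fun p : ℝ × Ω => v p.1 p.2 i) 2 (timeProd T P)) :
    Integrable (fun p : ℝ × Ω => quadForm (S p.1) (v p.1 p.2)) (timeProd T P) := by
  simp only [quadForm_eq_sum]
  exact integrable_finsetSum _ fun i _ => integrable_finsetSum _ fun j _ =>
    integrable_memLp_top_mul ((hS i j).comp_fst P) ((hv i).integrable_mul (hv j))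

theorem integrableOn_quadForm {k : ℕ} (S : Matrix (Fin k) (Fin k) ℝ) {v : ℝ → Fin k → ℝ}
    (hv : ∀ i, MemLp (fun t => v t i) ⊤ (volume.restrict (Icc 0 T))) :
    IntegrableOn (fun t => quadForm S (v t)) (Icc 0 T) := by
  simp only [quadForm_eq_sum]
  exact integrable_finsetSum _ fun i _ => integrable_finsetSum _ fun j _ =>
    (integrable_memLp_top_mul (hv i) ((hv j).integrable le_top)).const_mul _

theorem integral_quadForm_eq_sum {k : ℕ} (S : Matrix (Fin k) (Fin k) ℝ) {v : Ω → Fin k → ℝ}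
    (hv : ∀ i, MemLp (fun ω => v ω i) 2 P) :
    ∫ ω, quadForm S (v ω) ∂P = ∑ i, ∑ j, S i j * ∫ ω, v ω i * v ω j ∂P := by
  have hi : ∀ i j, Integrable (fun ω => S i j * (v ω i * v ω j)) P := fun i j =>
    ((hv i).integrable_mul (hv j)).const_mul _
  simp only [quadForm_eq_sum]
  rw [integral_finsetSum]
  · refine Finset.sum_congr rfl fun i _ => ?_
    rw [integral_finsetSum]
    · simp only [integral_const_mul]
    · exact fun j _ => hi i j
  · exact fun i _ => integrable_finsetSum _ fun j _ => hi i j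

/-- If `ξ` is uncorrelated with `V`, the expectation of a quadratic form of `V + ξ` is additive. -/
theorem integral_quadForm_add {k : ℕ} (S : Matrix (Fin k) (Fin k) ℝ) {V ξ : Ω → Fin k → ℝ}
    (hV : ∀ i, MemLp (fun ω => V ω i) 2 P) (hξ : ∀ i, MemLp (fun ω => ξ ω i) 2 P)
    (h0 : ∀ i j, ∫ ω, V ω i * ξ ω j ∂P = 0) :
    ∫ ω, quadForm S (V ω + ξ ω) ∂P =
      ∫ ω, quadForm S (V ω) ∂P + ∑ i, ∑ j, S i j * ∫ ω, ξ ω i * ξ ω j ∂P := by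
  have i1 : ∀ i j, Integrable (fun ω => V ω i * V ω j) P := fun i j => (hV i).integrable_mul (hV j)
  have i2 : ∀ i j, Integrable (fun ω => V ω i * ξ ω j) P := fun i j => (hV i).integrable_mul (hξ j)
  have i3 : ∀ i j, Integrable (fun ω => ξ ω i * ξ ω j) P := fun i j => (hξ i).integrable_mul (hξ j)
  rw [integral_quadForm_eq_sum S hV,
    integral_quadForm_eq_sum S (v := fun ω => V ω + ξ ω) fun i => (hV i).add (hξ i)]
  simp only [← Finset.sum_add_distrib, ← mul_add]
  refine Finset.sum_congr rfl fun i _ => Finset.sum_congr rfl fun j _ => ?_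
  congr 1
  have e : ∀ ω, (V ω + ξ ω) i * (V ω + ξ ω) j =
      V ω i * V ω j + V ω i * ξ ω j + V ω j * ξ ω i + ξ ω i * ξ ω j := fun ω => by
    simp only [Pi.add_apply]; ring
  have k1 := i1 i j
  have k2 := i2 i j
  have k3 := i2 j i
  have k4 := i3 i j
  simp only [e]
  rw [integral_add (by fun_prop) k4, integral_add (by fun_prop) k3, integral_add k1 k2, h0, h0]
  ring

/-! ### The second moments of the solution -/

/-- The identity at a single time: the expected cost of `X(r + h)` is that of the Artstein
transform at time `r`, plus the contribution of the noise on `[r, r + h]`. -/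
theorem IsSolution.integral_quadForm [IsProbabilityMeasure P] (hW : IsWienerProcess P ℱ W)
    (hX : IsSolution P ℱ W T h A B σ U X) (hA : IsLinfty T A)
    (hB : IsLinfty T B) (hσ : IsLinftyVec T σ) (hU : IsL2Adapted T P ℱ U) (hh : 0 ≤ h)
    (S : Matrix (Fin n) (Fin n) ℝ) {r : ℝ} (hr : r ∈ Icc 0 (T - h)) :
    ∫ ω, quadForm S (X (r + h) ω) ∂P =
      ∫ ω, quadForm ((fundamentalMatrix T A (r + h) r)ᵀ * S * fundamentalMatrix T A (r + h) r)
        (artstein T h A B U X r ω) ∂P +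
      ∫ s in r..(r + h), quadForm S (fundamentalMatrix T A (r + h) s *ᵥ σ s) := by
  have hT : 0 ≤ T := by linarith [hr.1, hr.2]
  obtain ⟨Ψ, Z, hp, hΦ⟩ := hA.exists_fundamentalMatrix_eq hT
  have hM := hX.isNoise hW hA hB hσ hU hh hT
  have hr' : r ∈ Icc 0 T := ⟨hr.1, by linarith [hr.2]⟩
  have ht' : r + h ∈ Icc 0 T := ⟨by linarith [hr.1], by linarith [hr.2]⟩
  have hrt : r ≤ r + h := by linarith
  have hX2 : ∀ t ∈ Icc 0 T, ∀ i, MemLp (fun ω => X t ω i) 2 P := fun t ht i =>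
    hX.memLp_time hp hA hB hU hh hT hM ht i
  have hY := memLp_artstein_time hp hΦ hB hU hh hX2 hr
  set ξ := noiseResponse A Ψ Z (noise h A B U X) r (r + h) with hξ
  have hξ2 : ∀ i, MemLp (fun ω => ξ ω i) 2 P := hM.memLp_noiseResponse hp hA hr' ht'
  set V : Ω → Fin n → ℝ := fun ω => (Ψ (r + h) * Z r) *ᵥ artstein T h A B U X r ω with hV
  have hV2 : ∀ i, MemLp (fun ω => V ω i) 2 P := memLp_mulVec_const _ hY
  have hYξ : ∀ i j, ∫ ω, artstein T h A B U X r ω i * ξ ω j ∂P = 0 := fun i j => by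
    have := hM.integral_mul_noiseResponse hp hA hr' ht' hrt (hY i) (g := fun _ => 0)
      (fun k => by simp) (fun s hs k => by
        rw [hX.integral_artstein_mul_noise_sub hp hΦ hB hU hh hM hX2 hr
          ⟨hr.1.trans hs.1, hs.2.trans ht'.2⟩ hs.1 i k]
        simp) j
    rw [hξ, this]
    simp
  have hVξ : ∀ i j, ∫ ω, V ω i * ξ ω j ∂P = 0 := fun i j => by
    simp only [mul_comm (V _ i)]
    rw [hV, integral_mul_mulVec _ (hξ2 j) hY]
    simp only [mul_comm (ξ _ j), hYξ]
    simp [Matrix.mulVec, dotProduct]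
  have e1 : ∫ ω, quadForm S (X (r + h) ω) ∂P = ∫ ω, quadForm S (V ω + ξ ω) ∂P := by
    refine integral_congr_ae ?_
    filter_upwards [hX.ae_eq_artstein_add hp hΦ hA hB hU hh] with ω hω
    have : X (r + h) ω = V ω + ξ ω := by
      ext i
      exact hω r hr i
    rw [this]
  rw [e1, integral_quadForm_add S hV2 hξ2 hVξ]
  congr 1
  · simp only [quadForm_transpose_mul_mul, hΦ _ ht' _ hr', hV]
  · have hΦσ : ∀ i, MemLp (fun u => ((Ψ (r + h) * Z u) *ᵥ σ u) i) ⊤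
        (volume.restrict (Icc 0 T)) := fun i => by
      simp only [Matrix.mulVec, dotProduct]
      exact memLp_finsetSum _ fun j _ =>
        (hσ j).mul' (((IsLinfty.const (Ψ (r + h))).mul hp.isLinfty_inv) i j)
    have hi : ∀ i j, IntervalIntegrable (fun u => ((Ψ (r + h) * Z u) *ᵥ σ u) i *
        ((Ψ (r + h) * Z u) *ᵥ σ u) j) volume r (r + h) := fun i j =>
      intervalIntegrable_of_integrableOn_Icc
        (integrable_memLp_top_mul (hΦσ i) ((hΦσ j).integrable le_top)) hr' ht'
    have e2 : ∫ s in r..(r + h), quadForm S (fundamentalMatrix T A (r + h) s *ᵥ σ s) =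
        ∫ s in r..(r + h), quadForm S ((Ψ (r + h) * Z s) *ᵥ σ s) := by
      refine intervalIntegral.integral_congr fun s hs => ?_
      rw [uIcc_of_le hrt] at hs
      rw [hΦ _ ht' s ⟨hr.1.trans hs.1, hs.2.trans ht'.2⟩]
    rw [e2]
    simp only [quadForm_eq_sum]
    rw [intervalIntegral.integral_finsetSum fun i _ => by
      simpa only [Finset.sum_fn] using IntervalIntegrable.sum Finset.univ
        (f := fun j u => S i j * (((Ψ (r + h) * Z u) *ᵥ σ u) i * ((Ψ (r + h) * Z u) *ᵥ σ u) j))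
        fun j _ => (hi i j).const_mul (S i j)]
    refine Finset.sum_congr rfl fun i _ => ?_
    rw [intervalIntegral.integral_finsetSum fun j _ => (hi i j).const_mul _]
    refine Finset.sum_congr rfl fun j _ => ?_
    rw [intervalIntegral.integral_const_mul,
      hM.integral_noiseResponse_mul_noiseResponse hp hA hσ hr' ht' hrt]
    simp only [mul_comm]

theorem intervalIntegrable_quadForm_fundamentalMatrix (hA : IsLinfty T A) (hσ : IsLinftyVec T σ)
    (S : Matrix (Fin n) (Fin n) ℝ) {r t : ℝ} (hr : r ∈ Icc 0 T) (ht : t ∈ Icc 0 T) :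
    IntervalIntegrable (fun s => quadForm S (fundamentalMatrix T A t s *ᵥ σ s)) volume r t := by
  obtain ⟨Ψ, Z, hp, hΦ⟩ := hA.exists_fundamentalMatrix_eq (hr.1.trans hr.2)
  refine intervalIntegrable_of_integrableOn_Icc (integrableOn_quadForm S fun i => ?_) hr ht
  have : MemLp (fun u => ((Ψ t * Z u) *ᵥ σ u) i) ⊤ (volume.restrict (Icc 0 T)) := by
    simp only [Matrix.mulVec, dotProduct]
    exact memLp_finsetSum _ fun j _ =>
      (hσ j).mul' (((IsLinfty.const (Ψ t)).mul hp.isLinfty_inv) i j)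
  refine (memLp_congr_ae ?_).1 this
  filter_upwards [ae_restrict_mem measurableSet_Icc] with s hs
  rw [hΦ t ht s hs]

/-- The transformed running cost is integrable on `[0, T - h] × Ω`. -/
theorem IsSolution.integrable_quadForm_Qbar [IsProbabilityMeasure P] (hW : IsWienerProcess P ℱ W)
    (hX : IsSolution P ℱ W T h A B σ U X) (hA : IsLinfty T A)
    (hB : IsLinfty T B) (hσ : IsLinftyVec T σ) (hU : IsL2Adapted T P ℱ U) (hh : 0 ≤ h) (hT : 0 ≤ T)
    {Q : ℝ → Matrix (Fin n) (Fin n) ℝ} (hQ : IsLinfty T Q) :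
    Integrable (fun p : ℝ × Ω => quadForm (Qbar T h A Q p.1) (artstein T h A B U X p.1 p.2))
      (timeProd (T - h) P) := by
  obtain ⟨Ψ, Z, hp, hΦ⟩ := hA.exists_fundamentalMatrix_eq hT
  have hM := hX.isNoise hW hA hB hσ hU hh hT
  have hY := memLp_artstein hp hΦ hB hU hh hT fun i => hX.memLp hp hA hB hU hh hT hM i
  have hQ' : IsLinfty (T - h) (fun t => Q (t + h)) := fun i j => memLp_shift hh (hQ i j)
  have hΦ' : IsLinfty (T - h) (fun t => Ψ (t + h) * Z t) :=
    IsLinfty.mul (fun i j => memLp_shift hh (hp.isLinfty i j)) fun i j =>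
      (hp.isLinfty_inv i j).mono_measure
        (Measure.restrict_mono (Icc_subset_Icc le_rfl (by linarith)) le_rfl)
  refine (integrable_congr ?_).1 (hQ'.integrable_quadForm
    (v := fun t ω => (Ψ (t + h) * Z t) *ᵥ artstein T h A B U X t ω) (hΦ'.memLp_mulVec hY))
  filter_upwards [ae_prod_of_ae (ae_restrict_mem (μ := volume) (s := Icc 0 (T - h))
    measurableSet_Icc) (Eventually.of_forall (f := ae P) fun _ => trivial)] with p hp'
  obtain ⟨hr, -⟩ := hp'
  rw [Qbar, quadForm_transpose_mul_mul, hΦ _ ⟨by linarith [hr.1], by linarith [hr.2]⟩ _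
    ⟨hr.1, by linarith [hr.2]⟩]

theorem ae_posSemidef_Qbar (hh : 0 ≤ h) {Q : ℝ → Matrix (Fin n) (Fin n) ℝ}
    (hQ : ∀ᵐ t ∂(volume.restrict (Icc 0 T)), (Q t).PosSemidef) :
    ∀ᵐ t ∂(volume.restrict (Icc 0 (T - h))), (Qbar T h A Q t).PosSemidef := by
  have hQ' := ae_restrict_of_ae_restrict_of_subset (Icc_subset_Icc hh (le_refl T)) hQ
  filter_upwards [(measurePreserving_add_Icc T h).quasiMeasurePreserving.ae hQ'] with t ht
  exact posSemidef_transpose_mul_mul ht _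

theorem integral_integral_intervalIntegral_swap [IsProbabilityMeasure P] {a b : ℝ} (hab : a ≤ b)
    {F : ℝ → Ω → ℝ}
    (hF : Integrable (fun p : ℝ × Ω => F p.1 p.2) ((volume.restrict (Icc a b)).prod P)) :
    Integrable (fun ω => ∫ t in a..b, F t ω) P ∧
      IntervalIntegrable (fun t => ∫ ω, F t ω ∂P) volume a b ∧
      ∫ ω, (∫ t in a..b, F t ω) ∂P = ∫ t in a..b, ∫ ω, F t ω ∂P := by
  simp only [intervalIntegral.integral_of_le hab, ← integral_Icc_eq_integral_Ioc]
  refine ⟨hF.integral_prod_right, ?_, (integral_integral_swap hF).symm⟩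
  exact (intervalIntegrable_iff_integrableOn_Icc_of_le hab).2 hF.integral_prod_left

end

end DelaySteering

open DelaySteering
theorem mainTheorem5 {n m : ℕ} {Ω : Type*} {mΩ : MeasurableSpace Ω}
    (P : Measure Ω) [IsProbabilityMeasure P]
    (ℱ : Filtration ℝ≥0 mΩ) (W : ℝ≥0 → Ω → ℝ) (hW : IsWienerProcess P ℱ W)
    (T h : ℝ) (hh : 0 < h) (hhT : h < T)
    (A : ℝ → Matrix (Fin n) (Fin n) ℝ) (hA : IsLinfty T A)
    (B : ℝ → Matrix (Fin n) (Fin m) ℝ) (hB : IsLinfty T B)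
    (σ : ℝ → Fin n → ℝ) (hσ : IsLinftyVec T σ)
    (Q : ℝ → Matrix (Fin n) (Fin n) ℝ) (hQ : IsLinfty T Q)
    (hQpos : ∀ᵐ t ∂(volume.restrict (Icc 0 T)), (Q t).PosSemidef)
    (G : Matrix (Fin n) (Fin n) ℝ) (hG : G.PosSemidef)
    (R : ℝ → Matrix (Fin m) (Fin m) ℝ) (hR : IsLinfty T R)
    (hRpos : ∀ᵐ t ∂(volume.restrict (Icc 0 T)), (R t).PosDef)
    (U : ℝ → Ω → Fin m → ℝ) (hU : IsL2Adapted T P ℱ U)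
    (X : ℝ → Ω → Fin n → ℝ) (hX : IsSolution P ℱ W T h A B σ U X) :
    -- all the expectations and time integrals below are finite
    (Integrable (fun p : ℝ × Ω => quadForm (Q p.1) (X p.1 p.2))
        ((volume.restrict (Icc h T)).prod P) ∧
      Integrable (fun ω => quadForm G (X T ω)) P ∧
      Integrable (fun p : ℝ × Ω => quadForm (R p.1) (U p.1 p.2))
        ((volume.restrict (Icc 0 (T - h))).prod P) ∧
      Integrable (fun p : ℝ × Ω => quadForm (Qbar T h A Q p.1) (artstein T h A B U X p.1 p.2))
        ((volume.restrict (Icc 0 (T - h))).prod P) ∧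
      Integrable (fun ω => quadForm (Gbar T h A G) (artstein T h A B U X (T - h) ω)) P ∧
      IntervalIntegrable (fun t => vMinAt T h A σ Q t) volume h T ∧
      (∀ t ∈ Icc h T, IntervalIntegrable
        (fun s => quadForm (Q t) (fundamentalMatrix T A t s *ᵥ σ s)) volume (t - h) t) ∧
      IntervalIntegrable
        (fun s => quadForm G (fundamentalMatrix T A T s *ᵥ σ s)) volume (T - h) T) ∧
    -- the transformed weights are symmetric positive
    ((∀ᵐ t ∂(volume.restrict (Icc 0 (T - h))), (Qbar T h A Q t).PosSemidef) ∧
      (Gbar T h A G).PosSemidef) ∧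
    -- the cost in terms of the Artstein transform
    cost P T h Q G R U X =
      (∫ ω, (∫ t in (0 : ℝ)..(T - h),
          quadForm (Qbar T h A Q t) (artstein T h A B U X t ω)) ∂P) +
        (∫ ω, quadForm (Gbar T h A G) (artstein T h A B U X (T - h) ω) ∂P) +
        (∫ ω, (∫ t in (0 : ℝ)..(T - h), quadForm (R t) (U t ω)) ∂P) +
        vMin T h A σ Q G ∧
    -- the control-independent constant is a lower bound
    vMin T h A σ Q G ≤ cost P T h Q G R U X := by
  have hT : 0 ≤ T := hh.le.trans hhT.le
  have hTh : 0 ≤ T - h := by linarith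
  have hhT' : Icc h T ⊆ Icc 0 T := Icc_subset_Icc hh.le le_rfl
  have hThT : Icc 0 (T - h) ⊆ Icc 0 T := Icc_subset_Icc le_rfl (by linarith)
  have hTm : T ∈ Icc 0 T := ⟨hT, le_rfl⟩
  obtain ⟨Ψ, Z, hp, hΦ⟩ := hA.exists_fundamentalMatrix_eq hT
  have hM := hX.isNoise hW hA hB hσ hU hh.le hT
  have hX2 : ∀ t ∈ Icc 0 T, ∀ i, MemLp (fun ω => X t ω i) 2 P := fun t ht i =>
    hX.memLp_time hp hA hB hU hh.le hT hM ht i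
  have iQ : Integrable (fun p : ℝ × Ω => quadForm (Q p.1) (X p.1 p.2))
      ((volume.restrict (Icc h T)).prod P) :=
    (hQ.integrable_quadForm fun i => hX.memLp hp hA hB hU hh.le hT hM i).mono_measure
      (Measure.prod_mono (Measure.restrict_mono hhT' le_rfl) le_rfl)
  have iG : Integrable (fun ω => quadForm G (X T ω)) P := integrable_quadForm G (hX2 T hTm)
  have iR : Integrable (fun p : ℝ × Ω => quadForm (R p.1) (U p.1 p.2))
      ((volume.restrict (Icc 0 (T - h))).prod P) :=
    (hR.integrable_quadForm fun l => hU.memLp.eval l).mono_measure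
      (Measure.prod_mono (Measure.restrict_mono hThT le_rfl) le_rfl)
  have iQb := hX.integrable_quadForm_Qbar hW hA hB hσ hU hh.le hT hQ
  have iGb : Integrable (fun ω => quadForm (Gbar T h A G) (artstein T h A B U X (T - h) ω)) P :=
    integrable_quadForm _ (memLp_artstein_time hp hΦ hB hU hh.le hX2 ⟨hTh, le_rfl⟩)
  obtain ⟨sQ1, sQ2, sQ3⟩ := integral_integral_intervalIntegral_swap hhT.le
    (F := fun t ω => quadForm (Q t) (X t ω)) iQ
  obtain ⟨-, sQb2, sQb3⟩ := integral_integral_intervalIntegral_swap hTh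
    (F := fun t ω => quadForm (Qbar T h A Q t) (artstein T h A B U X t ω)) iQb
  have hid : ∀ t ∈ Icc h T, vMinAt T h A σ Q t =
      ∫ ω, quadForm (Q t) (X t ω) ∂P -
        ∫ ω, quadForm (Qbar T h A Q (t - h)) (artstein T h A B U X (t - h) ω) ∂P :=
    fun t ht => by
      have := hX.integral_quadForm hW hA hB hσ hU hh.le (Q t) (r := t - h)
        ⟨by linarith [ht.1], by linarith [ht.2]⟩
      simp only [sub_add_cancel] at this
      simp only [this, Qbar, sub_add_cancel, vMinAt]
      ring
  have hidG : vMinAt T h A σ (fun _ => G) T = ∫ ω, quadForm G (X T ω) ∂P -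
      ∫ ω, quadForm (Gbar T h A G) (artstein T h A B U X (T - h) ω) ∂P := by
    have := hX.integral_quadForm hW hA hB hσ hU hh.le G (r := T - h) ⟨hTh, le_rfl⟩
    simp only [sub_add_cancel] at this
    simp only [this, Gbar, vMinAt]
    ring
  have sQb2' : IntervalIntegrable (fun t =>
      ∫ ω, quadForm (Qbar T h A Q (t - h)) (artstein T h A B U X (t - h) ω) ∂P) volume h T := by
    simpa using sQb2.comp_sub_right h
  have iV : IntervalIntegrable (fun t => vMinAt T h A σ Q t) volume h T :=
    (sQ2.sub sQb2').congr fun t ht => by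
      rw [uIoc_of_le hhT.le] at ht
      exact (hid t ⟨ht.1.le, ht.2⟩).symm
  have hQb := ae_posSemidef_Qbar (A := A) hh.le hQpos
  have hGb : (Gbar T h A G).PosSemidef := posSemidef_transpose_mul_mul hG _
  have hcost : cost P T h Q G R U X =
      (∫ ω, (∫ t in (0 : ℝ)..(T - h),
          quadForm (Qbar T h A Q t) (artstein T h A B U X t ω)) ∂P) +
        (∫ ω, quadForm (Gbar T h A G) (artstein T h A B U X (T - h) ω) ∂P) +
        (∫ ω, (∫ t in (0 : ℝ)..(T - h), quadForm (R t) (U t ω)) ∂P) +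
        vMin T h A σ Q G := by
    have e1 : ∫ t in h..T, vMinAt T h A σ Q t =
        (∫ t in h..T, ∫ ω, quadForm (Q t) (X t ω) ∂P) -
          ∫ t in h..T, ∫ ω,
            quadForm (Qbar T h A Q (t - h)) (artstein T h A B U X (t - h) ω) ∂P := by
      rw [← intervalIntegral.integral_sub sQ2 sQb2']
      refine intervalIntegral.integral_congr fun t ht => ?_
      rw [uIcc_of_le hhT.le] at ht
      exact hid t ht
    have e2 := intervalIntegral.integral_comp_sub_right (a := h) (b := T)
      (fun t => ∫ ω, quadForm (Qbar T h A Q t) (artstein T h A B U X t ω) ∂P) h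
    rw [sub_self] at e2
    rw [cost, vMin, integral_add sQ1 iG, sQ3, sQb3, e1, e2, hidG]
    ring
  refine ⟨⟨iQ, iG, iR, iQb, iGb, iV, fun t ht => ?_, ?_⟩, ⟨hQb, hGb⟩, hcost, ?_⟩
  · exact intervalIntegrable_quadForm_fundamentalMatrix hA hσ (Q t)
      ⟨by linarith [ht.1], by linarith [ht.2]⟩ (hhT' ht)
  · exact intervalIntegrable_quadForm_fundamentalMatrix hA hσ G ⟨hTh, by linarith⟩ hTm
  · have n1 : 0 ≤ ∫ ω, (∫ t in (0 : ℝ)..(T - h),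
        quadForm (Qbar T h A Q t) (artstein T h A B U X t ω)) ∂P :=
      integral_nonneg fun ω => intervalIntegral.integral_nonneg_of_ae_restrict hTh
        (hQb.mono fun t ht => quadForm_nonneg ht _)
    have n2 : 0 ≤ ∫ ω, quadForm (Gbar T h A G) (artstein T h A B U X (T - h) ω) ∂P :=
      integral_nonneg fun ω => quadForm_nonneg hGb _
    have n3 : 0 ≤ ∫ ω, (∫ t in (0 : ℝ)..(T - h), quadForm (R t) (U t ω)) ∂P :=
      integral_nonneg fun ω => intervalIntegral.integral_nonneg_of_ae_restrict hTh
        ((ae_restrict_of_ae_restrict_of_subset hThT hRpos).mono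
          fun t ht => quadForm_nonneg ht.posSemidef _)
    rw [hcost]
    linarith
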